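/- Let $d\ge1$, $q\ge1$ and $r>0$. To each site of $\mathbb{Z}^d$ associate the space $\mathbb{C}^q$. For each finite $\Lambda\subset\mathbb{Z}^d$ let $\mathfrak{U}_\Lambda$ be the algebra of linear operators on $(\mathbb{C}^q)^{\otimes\Lambda}$ with the operator norm $\|\cdot\|_\infty$. For $\Lambda\subseteq\Lambda'$ identify $A\in\mathfrak{U}_\Lambda$ with $A\otimes\mathbb{I}\in\mathfrak{U}_{\Lambda'}$, and let $\mathfrak{U}_{\mathbb{Z}^d}$ be the norm completion of $\bigcup_\Lambda\mathfrak{U}_\Lambda$. For $\Gamma\subseteq\mathbb{Z}^d$ let $\mathcal{O}_\Gamma$ be the set of self-adjoint elements of the norm closure of $\bigcup_{X\subseteq\Gamma\text{ finite}}\mathfrak{U}_X$. Let $\Phi=(\Phi(\Lambda))_\Lambda$, with $\Phi(\Lambda)\in\mathfrak{U}_\Lambda$ self-adjoint for every finite $\Lambda\subset\mathbb{Z}^d$, be a translation-invariant interaction in $\mathcal{B}^r_{\mathbb{Z}^d}$, i.e. $\sum_{\Lambda\ni0}e^{r(|\Lambda|-1)}\|\Phi(\Lambda)\|_\infty<\infty$.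 Set $H^\Phi_\Lambda=\sum_{X\subseteq\Lambda}\Phi(X)$, $E_\Phi=\sum_{\Lambda\ni0}\Phi(\Lambda)/|\Lambda|$, and $$\|\Phi\|_L=2\inf\Big\{\Big\|\sum_{\Lambda\ni0}\Phi(\Lambda)-A\Big\|_\infty:\ A\in\mathcal{O}_{\mathbb{Z}^d\setminus\{0\}}\Big\},$$ and let $\omega$ be the uniform state on $\mathfrak{U}_{\mathbb{Z}^d}$, i.e. $\omega(A)=q^{-|\Lambda|}\,\mathrm{Tr}_\Lambda A$ for every finite $\Lambda$ and every $A\in\mathfrak{U}_\Lambda$. For $a\in\mathbb{N}_+^d$ let $\Lambda_a=\{x\in\mathbb{Z}^d:-a\le x<a\}$ (componentwise). Then the pressure $$P(\Phi)=\lim_{a\to\infty}\frac{\ln\mathrm{Tr}_{\Lambda_a}e^{-H^\Phi_{\Lambda_a}}}{|\Lambda_a|}$$ (all components of $a$ tending to infinity) exists and satisfies $$P(\Phi)\le\ln q+\frac{\|\Phi\|_L^2}{2}-\omega(E_\Phi).$$ -/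

import Mathlib

namespace QSpin

open Filter Topology
open scoped Kronecker Matrix.Norms.L2Operator ComplexOrder

noncomputable section

/-- The sites of the lattice `ℤ^d`. -/
abbrev Site (d : ℕ) : Type := Fin d → ℤ

/-- The labels of the product basis of `⨂_{x ∈ Λ} ℂ^q`. -/
abbrev Config {d : ℕ} (q : ℕ) (Λ : Finset (Site d)) : Type := Λ → Fin q

/-- The algebra of linear operators on `⨂_{x ∈ Λ} ℂ^q`, as matrices in the product basis.
It carries the operator norm (induced by the Euclidean norm) and the conjugate transpose as `star`. -/
abbrev Alg {d : ℕ} (q : ℕ) (Λ : Finset (Site d)) : Type :=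
  Matrix (Config q Λ) (Config q Λ) ℂ

/-! ### The inclusion of the local algebras -/

/-- For `Λ ⊆ Λ'`, a configuration on `Λ'` is a configuration on `Λ` together with one on the
complement of `Λ` in `Λ'`. -/
def split {d : ℕ} (q : ℕ) {Λ Λ' : Finset (Site d)} (h : Λ ≤ Λ') :
    Config q Λ' ≃ Config q Λ × ({x : Λ' // x.1 ∉ Λ} → Fin q) where
  toFun s := (fun x => s ⟨x.1, h x.2⟩, fun x => s x.1)
  invFun p x := if hx : x.1 ∈ Λ then p.1 ⟨x.1, hx⟩ else p.2 ⟨x, hx⟩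
  left_inv s := by
    funext x
    by_cases hx : x.1 ∈ Λ <;> simp [hx]
  right_inv p := by
    refine Prod.ext ?_ ?_
    · funext x
      simp
    · funext x
      simp [x.2]

/-- The canonical unital inclusion `A ↦ A ⊗ 1` of the operators on `Λ` into those on `Λ' ⊇ Λ`. -/
def embed {d : ℕ} (q : ℕ) {Λ Λ' : Finset (Site d)} (h : Λ ≤ Λ') : Alg q Λ →⋆ₐ[ℂ] Alg q Λ' where
  toFun A := (A ⊗ₖ (1 : Matrix ({x : Λ' // x.1 ∉ Λ} → Fin q) ({x : Λ' // x.1 ∉ Λ} → Fin q) ℂ)).submatrix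
    (split q h) (split q h)
  map_one' := by simp
  map_mul' A B := by
    rw [Matrix.submatrix_mul_equiv, ← Matrix.mul_kronecker_mul, one_mul]
  map_zero' := by simp
  map_add' A B := by
    rw [Matrix.add_kronecker]; rfl
  commutes' c := by
    ext s t
    simp only [Matrix.algebraMap_eq_diagonal, Matrix.submatrix_apply]
    by_cases hst : s = t
    · subst hst; simp
    · have : ¬ (split q h s = split q h t) := fun e => hst ((split q h).injective e)
      rw [Prod.ext_iff, not_and_or] at this
      rcases this with h1 | h1 <;> simp [Matrix.diagonal_apply, Matrix.one_apply, h1, hst]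
  map_star' A := by
    rw [Matrix.star_eq_conjTranspose, Matrix.star_eq_conjTranspose, Matrix.conjTranspose_submatrix,
      Matrix.conjTranspose_kronecker, Matrix.conjTranspose_one]

theorem embed_apply {d q : ℕ} {Λ Λ' : Finset (Site d)} (h : Λ ≤ Λ') (A : Alg q Λ)
    (s t : Config q Λ') :
    embed q h A s t = A (fun x => s ⟨x.1, h x.2⟩) (fun x => t ⟨x.1, h x.2⟩) *
      (if ∀ x : Λ', x.1 ∉ Λ → s x = t x then 1 else 0) := by
  change A _ _ * (1 : Matrix _ _ ℂ) _ _ = _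
  rw [Matrix.one_apply]
  congr 1
  apply if_congr _ rfl rfl
  constructor
  · intro e x hx
    exact congrFun e ⟨x, hx⟩
  · intro e
    funext x
    exact e x.1 x.2

instance directedSystem (d q : ℕ) :
    DirectedSystem (fun Λ : Finset (Site d) => Alg q Λ) (fun _ _ h => embed q h) where
  map_self Λ A := by
    ext s t
    rw [embed_apply, if_pos (fun x hx => absurd x.2 hx), mul_one]
  map_map Λ₃ Λ₂ Λ₁ h12 h23 A := by
    ext s t
    rw [embed_apply, embed_apply, embed_apply, mul_assoc]
    congr 1
    rw [ite_zero_mul_ite_zero, mul_one]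
    apply if_congr _ rfl rfl
    constructor
    · rintro ⟨h1, h2⟩ x hx
      by_cases hx2 : x.1 ∈ Λ₂
      · exact h1 ⟨x.1, hx2⟩ hx
      · exact h2 x hx2
    · intro h1
      exact ⟨fun x hx => h1 ⟨x.1, h23 x.2⟩ hx, fun x hx => h1 x (fun h' => hx (h12 h'))⟩

theorem embed_injective {d q : ℕ} [NeZero q] {Λ Λ' : Finset (Site d)} (h : Λ ≤ Λ') :
    Function.Injective (embed q h) := by
  intro A B hAB
  ext s t
  have := congrFun (congrFun hAB ((split q h).symm (s, fun _ => 0)))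
    ((split q h).symm (t, fun _ => 0))
  simpa +contextual [embed_apply, split] using this

theorem norm_embed {d q : ℕ} [NeZero q] {Λ Λ' : Finset (Site d)} (h : Λ ≤ Λ') (A : Alg q Λ) :
    ‖embed q h A‖ = ‖A‖ :=
  NonUnitalStarAlgHom.norm_map (embed q h) (embed_injective h) A

/-! ### The strictly local algebra and the quasi-local algebra -/

/-- The strictly local algebra: the union (direct limit) of the algebras `Alg q Λ` along the
inclusions `embed`. -/
def LocalAlg (d q : ℕ) : Type :=
  DirectLimit (fun Λ : Finset (Site d) => Alg q Λ) (fun _ _ h => embed q h)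

namespace LocalAlg

variable {d q : ℕ}

instance : Ring (LocalAlg d q) :=
  inferInstanceAs (Ring (DirectLimit (fun Λ : Finset (Site d) => Alg q Λ) (fun _ _ h => embed q h)))

instance : Module ℂ (LocalAlg d q) :=
  inferInstanceAs
    (Module ℂ (DirectLimit (fun Λ : Finset (Site d) => Alg q Λ) (fun _ _ h => embed q h)))

instance : StarRing (LocalAlg d q) where
  toStarMul := inferInstanceAs (StarMul
    (DirectLimit (fun Λ : Finset (Site d) => Alg q Λ) (fun _ _ h => embed q h)))
  star_add := star_add (R := DirectLimit (fun Λ : Finset (Site d) => Alg q Λ)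
    (fun _ _ h => embed q h))

/-- A local operator, as an element of the strictly local algebra. -/
def mk (Λ : Finset (Site d)) : Alg q Λ →ₗ[ℂ] LocalAlg d q where
  toFun A := (⟦⟨Λ, A⟩⟧ : DirectLimit (fun Λ : Finset (Site d) => Alg q Λ) (fun _ _ h => embed q h))
  map_add' A B := (DirectLimit.add_def Λ A B).symm
  map_smul' c A := (DirectLimit.smul_def Λ A c).symm

theorem mk_embed {Λ Λ' : Finset (Site d)} (h : Λ ≤ Λ') (A : Alg q Λ) :
    mk Λ' (embed q h A) = mk Λ A :=
  DirectLimit.mk_apply (f := fun _ _ h => embed q h) Λ Λ' A h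

theorem mk_mul (Λ : Finset (Site d)) (A B : Alg q Λ) : mk Λ (A * B) = mk Λ A * mk Λ B :=
  (DirectLimit.mul_def (f := fun _ _ h => embed q h) Λ A B).symm

theorem mk_one (Λ : Finset (Site d)) : mk Λ (1 : Alg q Λ) = 1 :=
  (DirectLimit.one_def (f := fun _ _ h => embed q h) Λ).symm

theorem mk_star (Λ : Finset (Site d)) (A : Alg q Λ) : mk Λ (star A) = star (mk Λ A) :=
  (DirectLimit.star_def (f := fun _ _ h => embed q h) Λ A).symm

theorem exists_mk (A : LocalAlg d q) : ∃ (Λ : Finset (Site d)) (B : Alg q Λ), A = mk Λ B :=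
  DirectLimit.exists_eq_mk (f := fun _ _ h => embed q h) A

theorem exists_mk₂ (A B : LocalAlg d q) :
    ∃ (Λ : Finset (Site d)) (A' B' : Alg q Λ), A = mk Λ A' ∧ B = mk Λ B' :=
  DirectLimit.exists_eq_mk₂ (f := fun _ _ h => embed q h) A B

variable [NeZero q]

/-- The norm inherited from the operator norms of the algebras `Alg q Λ`. -/
instance : Norm (LocalAlg d q) where
  norm := DirectLimit.lift (fun _ _ h => embed q h) (fun _ A => ‖A‖)
    (fun _ _ h A => (norm_embed h A).symm)

theorem norm_mk (Λ : Finset (Site d)) (A : Alg q Λ) : ‖mk Λ A‖ = ‖A‖ := rfl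

instance : NormedRing (LocalAlg d q) :=
  { (inferInstance : Ring (LocalAlg d q)),
    NormedAddCommGroup.ofCore (𝕜 := ℂ) (E := LocalAlg d q)
      { norm_nonneg := fun A => by
          obtain ⟨Λ, A, rfl⟩ := exists_mk A
          exact norm_nonneg A
        norm_smul := fun c A => by
          obtain ⟨Λ, A, rfl⟩ := exists_mk A
          rw [← map_smul, norm_mk, norm_mk, norm_smul]
        norm_triangle := fun A B => by
          obtain ⟨Λ, A, B, rfl, rfl⟩ := exists_mk₂ A B
          rw [← map_add, norm_mk, norm_mk, norm_mk]
          exact norm_add_le A B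
        norm_eq_zero_iff := fun A => by
          obtain ⟨Λ, A, rfl⟩ := exists_mk A
          rw [norm_mk, norm_eq_zero]
          constructor
          · rintro rfl
            exact map_zero _
          · intro h
            have : ‖mk Λ A‖ = ‖mk Λ (0 : Alg q Λ)‖ := by rw [h, map_zero]
            rwa [norm_mk, norm_mk, norm_zero, norm_eq_zero] at this } with
    norm_mul_le := fun A B => by
      obtain ⟨Λ, A, B, rfl, rfl⟩ := exists_mk₂ A B
      rw [← mk_mul, norm_mk, norm_mk, norm_mk]
      exact norm_mul_le A B }

instance : NormedSpace ℂ (LocalAlg d q) where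
  norm_smul_le c A := by
    obtain ⟨Λ, A, rfl⟩ := exists_mk A
    rw [← map_smul, norm_mk, norm_mk, norm_smul]

instance : NormedStarGroup (LocalAlg d q) where
  norm_star_le A := by
    obtain ⟨Λ, A, rfl⟩ := exists_mk A
    rw [← mk_star, norm_mk, norm_mk, norm_star]

end LocalAlg

/-- The quasi-local algebra: the norm completion of the strictly local algebra. -/
abbrev QuasiLocal (d q : ℕ) [NeZero q] : Type := UniformSpace.Completion (LocalAlg d q)

section QuasiLocal

variable {d q : ℕ} [NeZero q]

theorem uniformContinuous_star_localAlg :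
    UniformContinuous (star : LocalAlg d q → LocalAlg d q) :=
  star_isometry.uniformContinuous

/-- The adjoint on the quasi-local algebra, extended by continuity from the local algebra. -/
instance : Star (QuasiLocal d q) where
  star := UniformSpace.Completion.map star

theorem continuous_star_quasiLocal : Continuous (star : QuasiLocal d q → QuasiLocal d q) :=
  UniformSpace.Completion.continuous_map

theorem coe_star (A : LocalAlg d q) : ((star A : LocalAlg d q) : QuasiLocal d q) = star (A : QuasiLocal d q) :=
  (UniformSpace.Completion.map_coe uniformContinuous_star_localAlg A).symm

instance : StarRing (QuasiLocal d q) where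
  star_involutive A := by
    induction A using UniformSpace.Completion.induction_on with
    | hp => exact isClosed_eq (continuous_star_quasiLocal.comp continuous_star_quasiLocal)
              continuous_id
    | ih A => rw [← coe_star, ← coe_star, star_star]
  star_mul A B := by
    induction A, B using UniformSpace.Completion.induction_on₂ with
    | hp => exact isClosed_eq (continuous_star_quasiLocal.comp continuous_mul)
              ((continuous_star_quasiLocal.comp continuous_snd).mul
                (continuous_star_quasiLocal.comp continuous_fst))
    | ih A B =>
      rw [← UniformSpace.Completion.coe_mul, ← coe_star, ← coe_star, ← coe_star,
        ← UniformSpace.Completion.coe_mul, star_mul]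
  star_add A B := by
    induction A, B using UniformSpace.Completion.induction_on₂ with
    | hp => exact isClosed_eq (continuous_star_quasiLocal.comp continuous_add)
              ((continuous_star_quasiLocal.comp continuous_fst).add
                (continuous_star_quasiLocal.comp continuous_snd))
    | ih A B =>
      rw [← UniformSpace.Completion.coe_add, ← coe_star, ← coe_star, ← coe_star,
        ← UniformSpace.Completion.coe_add, star_add]

/-- The inclusion of the operators on a finite region into the quasi-local algebra. -/
def incl (Λ : Finset (Site d)) : Alg q Λ →ₗ[ℂ] QuasiLocal d q :=
  (UniformSpace.Completion.toComplₗᵢ (𝕜 := ℂ) (E := LocalAlg d q)).toLinearMap ∘ₗ LocalAlg.mk Λ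

theorem incl_apply (Λ : Finset (Site d)) (A : Alg q Λ) :
    incl Λ A = ((LocalAlg.mk Λ A : LocalAlg d q) : QuasiLocal d q) := rfl

theorem norm_incl (Λ : Finset (Site d)) (A : Alg q Λ) : ‖incl Λ A‖ = ‖A‖ := by
  rw [incl_apply, UniformSpace.Completion.norm_coe, LocalAlg.norm_mk]

/-- The subalgebra (as a set) of the observables of a possibly infinite region `Γ`: the norm closure of
the union of the algebras of the finite subsets of `Γ`. -/
def regionAlg (q : ℕ) [NeZero q] (Γ : Set (Site d)) : Set (QuasiLocal d q) :=
  closure (⋃ X : {X : Finset (Site d) // (X : Set (Site d)) ⊆ Γ}, Set.range (incl (q := q) X.1))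

/-- The self-adjoint elements of the algebra of the region `Γ`. -/
def regionObs (q : ℕ) [NeZero q] (Γ : Set (Site d)) : Set (QuasiLocal d q) :=
  {A | A ∈ regionAlg q Γ ∧ IsSelfAdjoint A}

/-- The dependence on the site `x`: twice the distance of `H` from the
self-adjoint elements that do not act on `x`. -/
def siteDep (x : Site d) (H : QuasiLocal d q) : ℝ :=
  2 * ⨅ A : regionObs (d := d) q {x}ᶜ, ‖H - A.1‖

/-! ### States -/

/-- A state: a positive linear functional on the quasi-local algebra, normalized on the identity. -/
structure State (d q : ℕ) [NeZero q] where
  toFun : QuasiLocal d q →ₗ[ℂ] ℂ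
  nonneg : ∀ A : QuasiLocal d q, 0 ≤ toFun (star A * A)
  map_one : toFun 1 = 1

end QuasiLocal

/-- The normalized trace `A ↦ Tr A / q^|Λ|`. -/
def ntr {d q : ℕ} (Λ : Finset (Site d)) : Alg q Λ →ₗ[ℂ] ℂ :=
  ((q : ℂ) ^ Λ.card)⁻¹ • Matrix.traceLinearMap (Config q Λ) ℂ ℂ

theorem ntr_apply {d q : ℕ} (Λ : Finset (Site d)) (A : Alg q Λ) :
    ntr Λ A = A.trace / (q : ℂ) ^ Λ.card := by
  simp [ntr, div_eq_inv_mul]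

section Uniform

variable {d q : ℕ} [NeZero q]

theorem ntr_one (Λ : Finset (Site d)) : ntr Λ (1 : Alg q Λ) = 1 := by
  have : (q : ℂ) ≠ 0 := Nat.cast_ne_zero.2 (NeZero.ne q)
  rw [ntr_apply, Matrix.trace_one]
  simp [this]

theorem ntr_embed {Λ Λ' : Finset (Site d)} (h : Λ ≤ Λ') (A : Alg q Λ) :
    ntr Λ' (embed q h A) = ntr Λ A := by
  have hq : (q : ℂ) ≠ 0 := Nat.cast_ne_zero.2 (NeZero.ne q)
  have e1 : (embed q h A).trace =
      (A ⊗ₖ (1 : Matrix ({x : Λ' // x.1 ∉ Λ} → Fin q) ({x : Λ' // x.1 ∉ Λ} → Fin q) ℂ)).trace :=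
    (split q h).sum_comp (fun p => (A ⊗ₖ (1 : Matrix ({x : Λ' // x.1 ∉ Λ} → Fin q) _ ℂ)) p p)
  have e2 : q ^ Λ'.card = q ^ Λ.card * Fintype.card ({x : Λ' // x.1 ∉ Λ} → Fin q) := by
    have := Fintype.card_congr (split q h)
    simpa [Config] using this
  have e3 : (q : ℂ) ^ Λ'.card = (q : ℂ) ^ Λ.card *
      (Fintype.card ({x : Λ' // x.1 ∉ Λ} → Fin q) : ℂ) := by exact_mod_cast e2
  have h3 : (Fintype.card ({x : Λ' // x.1 ∉ Λ} → Fin q) : ℂ) ≠ 0 := by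
    intro h0
    rw [h0, mul_zero] at e3
    exact pow_ne_zero _ hq e3
  rw [ntr_apply, ntr_apply, e1, Matrix.trace_kronecker, Matrix.trace_one, e3]
  exact mul_div_mul_right _ _ h3

theorem norm_ntr_le (Λ : Finset (Site d)) (A : Alg q Λ) : ‖ntr Λ A‖ ≤ ‖A‖ := by
  have hq : (0 : ℝ) < (q : ℝ) ^ Λ.card := pow_pos (Nat.cast_pos.2 (NeZero.pos q)) _
  have hent : ∀ s, ‖A s s‖ ≤ ‖A‖ := fun s => by
    have h1 := Matrix.l2_opNorm_mulVec A (EuclideanSpace.single s (1 : ℂ))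
    have h2 := PiLp.norm_apply_le ((EuclideanSpace.equiv _ ℂ).symm
      (A.mulVec (EuclideanSpace.single s (1 : ℂ)))) s
    have h3 : ((EuclideanSpace.equiv _ ℂ).symm
      (A.mulVec (EuclideanSpace.single s (1 : ℂ)))) s = A s s := by
      simp
    rw [h3] at h2
    simpa using h2.trans h1
  rw [ntr_apply, norm_div, norm_pow, Complex.norm_natCast, div_le_iff₀ hq]
  calc ‖A.trace‖ ≤ ∑ s : Config q Λ, ‖A s s‖ := norm_sum_le _ _
    _ ≤ ∑ _s : Config q Λ, ‖A‖ := Finset.sum_le_sum (fun s _ => hent s)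
    _ = ‖A‖ * (q : ℝ) ^ Λ.card := by simp [Config, mul_comm]

/-- The normalized trace on the strictly local algebra. -/
def localTrace (d q : ℕ) [NeZero q] : LocalAlg d q →L[ℂ] ℂ :=
  LinearMap.mkContinuous
    { toFun := DirectLimit.lift (fun _ _ h => embed q h) (fun Λ A => ntr Λ A)
        (fun _ _ h A => (ntr_embed h A).symm)
      map_add' := fun A B => by
        obtain ⟨Λ, A, B, rfl, rfl⟩ := LocalAlg.exists_mk₂ A B
        rw [← map_add]
        exact map_add (ntr Λ) A B
      map_smul' := fun c A => by
        obtain ⟨Λ, A, rfl⟩ := LocalAlg.exists_mk A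
        rw [← map_smul]
        exact map_smul (ntr Λ) c A } 1
    (fun A => by
      obtain ⟨Λ, A, rfl⟩ := LocalAlg.exists_mk A
      rw [one_mul]
      exact norm_ntr_le Λ A)

theorem localTrace_mk (Λ : Finset (Site d)) (A : Alg q Λ) :
    localTrace d q (LocalAlg.mk Λ A) = ntr Λ A := rfl

/-- The continuous extension of the normalized trace to the quasi-local algebra. -/
def traceFunctional (d q : ℕ) [NeZero q] : QuasiLocal d q →L[ℂ] ℂ :=
  (localTrace d q).extend (UniformSpace.Completion.toComplL (𝕜 := ℂ) (E := LocalAlg d q))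

theorem traceFunctional_coe (A : LocalAlg d q) :
    traceFunctional d q (A : QuasiLocal d q) = localTrace d q A :=
  ContinuousLinearMap.extend_eq (localTrace d q)
    (UniformSpace.Completion.denseRange_coe) (UniformSpace.Completion.isUniformInducing_coe _) A

/-- The uniform (maximally mixed) state. -/
def uniformState (d q : ℕ) [NeZero q] : State d q where
  toFun := (traceFunctional d q).toLinearMap
  nonneg A := by
    induction A using UniformSpace.Completion.induction_on with
    | hp => exact isClosed_le continuous_const ((traceFunctional d q).continuous.comp
              (continuous_star_quasiLocal.mul continuous_id))
    | ih A =>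
      obtain ⟨Λ, A, rfl⟩ := LocalAlg.exists_mk A
      rw [← coe_star, ← UniformSpace.Completion.coe_mul, ← LocalAlg.mk_star, ← LocalAlg.mk_mul]
      change 0 ≤ traceFunctional d q _
      rw [traceFunctional_coe, localTrace_mk, ntr_apply]
      have h1 : 0 ≤ (star A * A).trace :=
        (Matrix.posSemidef_conjTranspose_mul_self A).trace_nonneg
      have h2 : (0 : ℂ) ≤ ((q : ℂ) ^ Λ.card)⁻¹ := by
        have : (0 : ℝ) ≤ ((q : ℝ) ^ Λ.card)⁻¹ := by positivity
        have h3 : (((q : ℂ) ^ Λ.card)⁻¹) = ((((q : ℝ) ^ Λ.card)⁻¹ : ℝ) : ℂ) := by push_cast; rfl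
        rw [h3]
        exact Complex.zero_le_real.2 this
      rw [div_eq_mul_inv]
      exact mul_nonneg h1 h2
  map_one := by
    change traceFunctional d q ((1 : LocalAlg d q) : QuasiLocal d q) = 1
    rw [traceFunctional_coe, ← LocalAlg.mk_one ∅, localTrace_mk, ntr_one]

/-- The marginal of the uniform state on every finite `Λ` is `1 / q^|Λ|`. -/
theorem uniformState_incl (Λ : Finset (Site d)) (A : Alg q Λ) :
    (uniformState d q).toFun (incl Λ A) = A.trace / (q : ℂ) ^ Λ.card := by
  change traceFunctional d q (incl Λ A) = _
  rw [incl_apply, traceFunctional_coe, localTrace_mk, ntr_apply]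

end Uniform

/-! ### Interactions -/

/-- The translate `Λ + x`. -/
def shift {d : ℕ} (x : Site d) (Λ : Finset (Site d)) : Finset (Site d) :=
  Λ.map (Equiv.addRight x).toEmbedding

theorem add_mem_shift {d : ℕ} (x : Site d) {Λ : Finset (Site d)} {y : Site d} (hy : y ∈ Λ) :
    y + x ∈ shift x Λ :=
  Finset.mem_map_of_mem _ hy

/-- The translation `τ_x`, from the operators on `Λ` to the operators on `Λ + x`. -/
def translate {d q : ℕ} (x : Site d) (Λ : Finset (Site d)) (A : Alg q Λ) : Alg q (shift x Λ) :=
  A.submatrix (fun s y => s ⟨y.1 + x, add_mem_shift x y.2⟩)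
    (fun s y => s ⟨y.1 + x, add_mem_shift x y.2⟩)

/-- An interaction: a self-adjoint operator on every finite region. -/
structure Interaction (d q : ℕ) where
  toFun : ∀ Λ : Finset (Site d), Alg q Λ
  selfAdjoint : ∀ Λ, IsSelfAdjoint (toFun Λ)

namespace Interaction

variable {d q : ℕ}

/-- `Φ(Λ + x) = τ_x Φ(Λ)` for all `Λ` and `x`. -/
def TranslationInvariant (Φ : Interaction d q) : Prop :=
  ∀ (Λ : Finset (Site d)) (x : Site d), Φ.toFun (shift x Λ) = translate x Λ (Φ.toFun Λ)

/-- The space `𝓑^r`: translation-invariant interactions with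
`∑_{Λ ∋ 0} e^{r(|Λ| - 1)} ‖Φ(Λ)‖ < ∞`. -/
structure MemB (r : ℝ) (Φ : Interaction d q) : Prop where
  translationInvariant : Φ.TranslationInvariant
  summable : Summable (fun Λ : {Λ : Finset (Site d) // (0 : Site d) ∈ Λ} =>
    Real.exp (r * ((Λ.1.card : ℝ) - 1)) * ‖Φ.toFun Λ.1‖)

/-- The local Hamiltonian with open boundary conditions, `H_Λ = ∑_{X ⊆ Λ} Φ(X)`. -/
def hamiltonian (Φ : Interaction d q) (Λ : Finset (Site d)) : Alg q Λ :=
  ∑ X : {X : Finset (Site d) // X ∈ Λ.powerset},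
    embed q (Finset.mem_powerset.1 X.2) (Φ.toFun X.1)

end Interaction

/-- The box `Λ_a = {x : -a ≤ x < a}`. -/
def box {d : ℕ} (a : Fin d → ℕ+) : Finset (Site d) :=
  Fintype.piFinset (fun i => Finset.Ico (-((a i : ℕ) : ℤ)) ((a i : ℕ) : ℤ))

namespace Interaction

variable {d q : ℕ}

/-- The finite-volume pressure `ln Tr e^{-H_Λ} / |Λ|` of the box `Λ = Λ_a`. -/
def boxPressure (Φ : Interaction d q) (a : Fin d → ℕ+) : ℝ :=
  Real.log (NormedSpace.exp (-(Φ.hamiltonian (box a)))).trace.re / ((box a).card : ℝ)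

/-- The pressure: the limit of the finite-volume pressures as all the sides of the box tend to
infinity. -/
def pressure (Φ : Interaction d q) : ℝ :=
  limUnder atTop Φ.boxPressure

theorem MemB.summable_norm {Φ : Interaction d q} {r : ℝ} (hr : 0 < r) (hΦ : Φ.MemB r) :
    Summable (fun Λ : {Λ : Finset (Site d) // (0 : Site d) ∈ Λ} => ‖Φ.toFun Λ.1‖) := by
  refine Summable.of_nonneg_of_le (fun _ => norm_nonneg _) (fun Λ => ?_) hΦ.summable
  have h1 : (1 : ℝ) ≤ (Λ.1.card : ℝ) := by
    exact_mod_cast Finset.card_pos.2 ⟨0, Λ.2⟩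
  have h2 : 1 ≤ Real.exp (r * ((Λ.1.card : ℝ) - 1)) :=
    Real.one_le_exp (mul_nonneg hr.le (by linarith))
  exact le_mul_of_one_le_left (norm_nonneg _) h2

variable [NeZero q]

/-- The specific energy observable `E_Φ = ∑_{Λ ∋ 0} Φ(Λ) / |Λ|`. -/
def energy (Φ : Interaction d q) : QuasiLocal d q :=
  ∑' Λ : {Λ : Finset (Site d) // (0 : Site d) ∈ Λ}, ((Λ.1.card : ℂ)⁻¹) • incl Λ.1 (Φ.toFun Λ.1)

/-- The Lipschitz constant of `Φ`: the dependence on the site `0` of `∑_{Λ ∋ 0} Φ(Λ)`. -/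
def lipschitz (Φ : Interaction d q) : ℝ :=
  siteDep 0 (∑' Λ : {Λ : Finset (Site d) // (0 : Site d) ∈ Λ}, incl Λ.1 (Φ.toFun Λ.1))

/-- The series in the definition of the Lipschitz constant converges. -/
theorem MemB.summable_incl {Φ : Interaction d q} {r : ℝ} (hr : 0 < r) (hΦ : Φ.MemB r) :
    Summable (fun Λ : {Λ : Finset (Site d) // (0 : Site d) ∈ Λ} => incl Λ.1 (Φ.toFun Λ.1)) := by
  refine Summable.of_norm ?_
  simpa only [norm_incl] using hΦ.summable_norm hr

/-- The series in the definition of the specific energy observable converges. -/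
theorem MemB.summable_energy {Φ : Interaction d q} {r : ℝ} (hr : 0 < r) (hΦ : Φ.MemB r) :
    Summable (fun Λ : {Λ : Finset (Site d) // (0 : Site d) ∈ Λ} =>
      ((Λ.1.card : ℂ)⁻¹) • incl Λ.1 (Φ.toFun Λ.1)) := by
  refine Summable.of_norm (Summable.of_nonneg_of_le (fun _ => norm_nonneg _) (fun Λ => ?_)
    (hΦ.summable_norm hr))
  have h1 : (1 : ℝ) ≤ (Λ.1.card : ℝ) := by
    exact_mod_cast Finset.card_pos.2 ⟨0, Λ.2⟩
  rw [norm_smul, norm_incl, norm_inv, Complex.norm_natCast]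
  exact mul_le_of_le_one_left (norm_nonneg _) (inv_le_one_of_one_le₀ h1)

end Interaction

end

end QSpin

namespace QSpin

open Filter Topology
open scoped Kronecker Matrix.Norms.L2Operator ComplexOrder MatrixOrder

/-! ### Trace inequalities -/

/-! The bound is Gaussian concentration for the normalized trace, obtained by averaging out the
sites one at a time. Let E_x be the normalized partial trace over x (`siteAvg`), and suppose D = A -
E_x A has norm at most L. Golden–Thompson gives Tr e^A ≤ Tr(e^{E_x A} e^D), and convexity gives e^D
≤ cosh L + (sinh L / L) D. The linear term drops out, because e^{E_x A} commutes with every operator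
on x and so Tr(e^{E_x A} D) = 0. As cosh L ≤ e^{L²/2}, averaging one site costs a factor e^{L²/2}
(`trace_exp_le_trace_exp_siteAvg`). The E_x commute and are contractive on self-adjoint operators,
so the bounds for the remaining sites survive. After all sites only the scalar ntr(A) is left
(`trace_exp_le_of_norm_sub_siteAvg_le`).

For A = -H_Λ the cost at x is governed by ‖H_Λ - E_x H_Λ‖. Operators not acting on x are fixed by
E_x, so this is at most twice the distance of H_Λ from them, hence at most ‖Φ‖_L plus twice the
strength of the terms through x that leave Λ (`norm_hamiltonian_sub_siteAvg_le`). Averaged over a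
growing box that error vanishes (`tendsto_average_tail`). The same tails show that the mean energy
per site tends to ω(E_Φ) (`tendsto_ntr_hamiltonian`).

The limit exists by Fekete's lemma on boxes. The log-partition function is subadditive only up to
the norms of the terms joining two regions, so the total strength of the terms inside a region is
subtracted as a compensator. The compensated function and the negated strength are both subadditive
up to constants, and the pressure is the difference of their limits (`exists_tendsto_boxPressure`).
-/

theorem trace_mul_conjTranspose_re {n : Type*} [Fintype n] (X : Matrix n n ℂ) :
    (X * X.conjTranspose).trace.re = ∑ i, ∑ j, ‖X i j‖ ^ 2 := by
  simp only [Matrix.trace, Matrix.diag_apply, Matrix.mul_apply, Complex.re_sum,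
    Matrix.conjTranspose_apply]
  refine Finset.sum_congr rfl fun i _ => Finset.sum_congr rfl fun j _ => ?_
  rw [Complex.star_def, Complex.mul_conj, Complex.normSq_eq_norm_sq, Complex.ofReal_re]

theorem norm_trace_mul_le {n : Type*} [Fintype n] (X Y : Matrix n n ℂ) :
    ‖(X * Y).trace‖ ≤
      ((X * X.conjTranspose).trace.re + (Y * Y.conjTranspose).trace.re) / 2 := by
  rw [trace_mul_conjTranspose_re, trace_mul_conjTranspose_re,
    Finset.sum_comm (f := fun i j => ‖Y i j‖ ^ 2), ← Finset.sum_add_distrib, Finset.sum_div]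
  refine (norm_sum_le _ _).trans (Finset.sum_le_sum fun i _ => ?_)
  rw [← Finset.sum_add_distrib, Finset.sum_div, Matrix.diag_apply, Matrix.mul_apply]
  refine (norm_sum_le _ _).trans (Finset.sum_le_sum fun j _ => ?_)
  rw [norm_mul]
  nlinarith [sq_nonneg (‖X i j‖ - ‖Y j i‖)]

section TraceInequalities

variable {n : Type*} [Fintype n] [DecidableEq n]

theorem trace_mul_nonneg {P Q : Matrix n n ℂ} (hP : 0 ≤ P) (hQ : 0 ≤ Q) : 0 ≤ (P * Q).trace := by
  obtain ⟨X, rfl⟩ := CStarAlgebra.nonneg_iff_eq_star_mul_self.mp hP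
  rw [mul_assoc, Matrix.trace_mul_comm]
  exact ((Matrix.nonneg_iff_posSemidef.1 hQ).mul_mul_conjTranspose_same X).trace_nonneg

theorem trace_mul_le {P Q R : Matrix n n ℂ} (hP : 0 ≤ P) (hQ : Q ≤ R) :
    (P * Q).trace.re ≤ (P * R).trace.re := by
  have h := trace_mul_nonneg hP (sub_nonneg.2 hQ)
  rw [mul_sub, Matrix.trace_sub] at h
  have := (Complex.le_def.1 h).1
  simpa using this

theorem trace_mul_pow_comm (X Y : Matrix n n ℂ) (m : ℕ) :
    ((X * Y) ^ m).trace = ((Y * X) ^ m).trace := by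
  cases m with
  | zero => simp
  | succ m =>
    have h : ∀ k : ℕ, (X * Y) ^ k * X = X * (Y * X) ^ k := fun k => by
      induction k with
      | zero => simp
      | succ k ih => rw [pow_succ', mul_assoc, ih, pow_succ']; simp only [mul_assoc]
    rw [pow_succ, ← mul_assoc, h, mul_assoc, Matrix.trace_mul_comm, pow_succ, mul_assoc]

/-- The two claims feed each other. For the first, apply it to X² and cycle the trace, which gives
Tr (RS)^{2^k} with R = X*X and S = XX*. The second claim separates the powers, and since R and S
have equal power traces, `norm_trace_mul_le` merges them into one. For the second, apply the first
to PQ and cycle PQQP into P²Q². -/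
theorem trace_pow_inequalities (k : ℕ) :
    (∀ X : Matrix n n ℂ, ‖(X ^ 2 ^ (k + 1)).trace‖ ≤
      ((X * X.conjTranspose) ^ 2 ^ k).trace.re) ∧
    ∀ P Q : Matrix n n ℂ, 0 ≤ P → 0 ≤ Q →
      ‖((P * Q) ^ 2 ^ k).trace‖ ≤ (P ^ 2 ^ k * Q ^ 2 ^ k).trace.re := by
  induction k with
  | zero =>
    refine ⟨fun X => ?_, fun P Q hP hQ => ?_⟩
    · have := norm_trace_mul_le X X
      simp only [zero_add, pow_one, pow_zero]
      rw [pow_two]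
      linarith
    · have h := trace_mul_nonneg hP hQ
      simp only [pow_zero, pow_one]
      exact (Complex.le_def.1 (Complex.eq_coe_norm_of_nonneg h).ge).1
  | succ k ih =>
    obtain ⟨ih1, ih2⟩ := ih
    refine ⟨fun X => ?_, fun P Q hP hQ => ?_⟩
    · have h1 := ih1 (X ^ 2)
      rw [← pow_mul, ← pow_succ'] at h1
      refine h1.trans ?_
      set R := X.conjTranspose * X with hR
      set S := X * X.conjTranspose with hS
      have hR0 : 0 ≤ R := (Matrix.posSemidef_conjTranspose_mul_self X).nonneg
      have hS0 : 0 ≤ S := (Matrix.posSemidef_self_mul_conjTranspose X).nonneg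
      have e1 : ((X ^ 2 * (X ^ 2).conjTranspose) ^ 2 ^ k).trace = ((R * S) ^ 2 ^ k).trace := by
        have : X ^ 2 * (X ^ 2).conjTranspose = X * (S * X.conjTranspose) := by
          rw [pow_two, Matrix.conjTranspose_mul, hS]; simp only [mul_assoc]
        rw [this, trace_mul_pow_comm, trace_mul_pow_comm R S, hR, mul_assoc]
      rw [e1]
      refine (Complex.re_le_norm _).trans ((ih2 R S hR0 hS0).trans ?_)
      have hsa : ∀ {T : Matrix n n ℂ}, 0 ≤ T → (T ^ 2 ^ k) * (T ^ 2 ^ k).conjTranspose = T ^ 2 ^ (k+1) := by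
        intro T hT
        rw [Matrix.conjTranspose_pow, (Matrix.nonneg_iff_posSemidef.1 hT).1.eq, ← pow_add]; ring_nf
      have h2 := (Complex.re_le_norm _).trans (norm_trace_mul_le (R ^ 2 ^ k) (S ^ 2 ^ k))
      rw [hsa hR0, hsa hS0] at h2
      have h3 : (R ^ 2 ^ (k + 1)).trace = (S ^ 2 ^ (k + 1)).trace := trace_mul_pow_comm _ _ _
      rw [h3] at h2
      linarith
    · refine (ih1 (P * Q)).trans ?_
      have e1 : ((P * Q * (P * Q).conjTranspose) ^ 2 ^ k).trace =
          ((P ^ 2 * Q ^ 2) ^ 2 ^ k).trace := by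
        rw [Matrix.conjTranspose_mul, (Matrix.nonneg_iff_posSemidef.1 hP).1.eq, (Matrix.nonneg_iff_posSemidef.1 hQ).1.eq, ← mul_assoc,
          trace_mul_pow_comm, pow_two, pow_two]
        simp only [mul_assoc]
      have hsq : ∀ {T : Matrix n n ℂ}, 0 ≤ T → 0 ≤ T ^ 2 := fun {T} hT =>
        ((Matrix.nonneg_iff_posSemidef.1 hT).pow 2).nonneg
      rw [e1]
      refine (Complex.re_le_norm _).trans ((ih2 _ _ (hsq hP) (hsq hQ)).trans (le_of_eq ?_))
      rw [← pow_mul, ← pow_mul, ← pow_succ']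

theorem norm_exp_le_of_isSelfAdjoint [Nonempty n] {A : Matrix n n ℂ} (hA : IsSelfAdjoint A) :
    ‖NormedSpace.exp A‖ ≤ Real.exp ‖A‖ := by
  rw [← CFC.real_exp_eq_normedSpace_exp hA]
  refine norm_cfc_le (Real.exp_nonneg _) fun x hx => ?_
  rw [Real.norm_of_nonneg (Real.exp_nonneg _)]
  exact Real.exp_le_exp.2 ((Real.le_norm_self x).trans (spectrum.norm_le_norm_of_mem hx))

end TraceInequalities

/-- Telescoping: the factors are exchanged one at a time, and the other m - 1 contribute at most c
each. -/
theorem norm_pow_sub_pow_le {R : Type*} [NormedRing R] [NormOneClass R] {X Y : R} {c : ℝ}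
    (hX : ‖X‖ ≤ c) (hY : ‖Y‖ ≤ c) (m : ℕ) :
    ‖X ^ m - Y ^ m‖ ≤ m * c ^ (m - 1) * ‖X - Y‖ := by
  have hc : 0 ≤ c := (norm_nonneg X).trans hX
  induction m with
  | zero => simp
  | succ m ih =>
    have e : X ^ (m + 1) - Y ^ (m + 1) = X ^ m * (X - Y) + (X ^ m - Y ^ m) * Y := by
      rw [pow_succ, pow_succ]; noncomm_ring
    rw [e]
    have h1 : ‖X ^ m * (X - Y)‖ ≤ c ^ m * ‖X - Y‖ :=
      (norm_mul_le _ _).trans (by gcongr; exact (norm_pow_le _ _).trans (by gcongr))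
    have h2 : ‖(X ^ m - Y ^ m) * Y‖ ≤ m * c ^ m * ‖X - Y‖ := by
      refine (norm_mul_le _ _).trans ?_
      refine (mul_le_mul ih hY (norm_nonneg _) (by positivity)).trans (le_of_eq ?_)
      cases m with
      | zero => simp
      | succ m => simp only [Nat.add_sub_cancel, pow_succ]; ring
    refine (norm_add_le _ _).trans ((add_le_add h1 h2).trans (le_of_eq ?_))
    push_cast [Nat.add_sub_cancel]; ring

/-! ### Trotter's product formula and Golden–Thompson -/

section Trotter

variable {n : Type*} [Fintype n] [DecidableEq n] [Nonempty n]

/-- The defect D(t) of the one-step product vanishes to first order at t = 0, so m‖D(1/m)‖ → 0.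
Telescoping multiplies it only by a constant, since the exponentials of A/m and B/m have norms at
most e^{‖A‖/m} and e^{‖B‖/m}. -/
theorem tendsto_trotter {A B : Matrix n n ℂ} (hA : IsSelfAdjoint A) (hB : IsSelfAdjoint B) :
    Tendsto (fun m : ℕ => (NormedSpace.exp ((m : ℝ)⁻¹ • A) * NormedSpace.exp ((m : ℝ)⁻¹ • B)) ^ m)
      atTop (𝓝 (NormedSpace.exp (A + B))) := by
  set D : ℝ → Matrix n n ℂ := fun t =>
    NormedSpace.exp (t • A) * NormedSpace.exp (t • B) - NormedSpace.exp (t • (A + B)) with hD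
  have hder : HasDerivAt D 0 0 := by
    have h := ((hasDerivAt_exp_smul_const A (0 : ℝ)).mul (hasDerivAt_exp_smul_const B (0 : ℝ))).sub
      (hasDerivAt_exp_smul_const (A + B) (0 : ℝ))
    refine h.congr_deriv ?_
    simp
  have hD0 : D 0 = 0 := by simp [hD]
  have hsl : Tendsto (fun m : ℕ => (m : ℝ) * ‖D ((m : ℝ)⁻¹)‖) atTop (𝓝 0) := by
    have h1 := hder.tendsto_slope_zero_right
    have h2 : Tendsto (fun m : ℕ => ((m : ℝ))⁻¹) atTop (𝓝[>] 0) :=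
      tendsto_inv_atTop_nhdsGT_zero.comp tendsto_natCast_atTop_atTop
    have h3 := (h1.comp h2).norm
    simp only [norm_zero] at h3
    refine h3.congr fun m => ?_
    simp [hD0, norm_smul]
  set c := Real.exp (‖A‖ + ‖B‖) with hc
  have hb : ∀ m : ℕ, 1 ≤ m → ‖(NormedSpace.exp ((m : ℝ)⁻¹ • A) * NormedSpace.exp ((m : ℝ)⁻¹ • B)) ^ m
      - NormedSpace.exp (A + B)‖ ≤ c * ((m : ℝ) * ‖D ((m : ℝ)⁻¹)‖) := by
    intro m hm
    have hm0 : (0 : ℝ) < m := by exact_mod_cast hm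
    have e : NormedSpace.exp (A + B) = NormedSpace.exp ((m : ℝ)⁻¹ • (A + B)) ^ m := by
      rw [← Matrix.exp_nsmul, ← Nat.cast_smul_eq_nsmul ℝ, smul_smul, mul_inv_cancel₀ hm0.ne',
        one_smul]
    have hs : ∀ {C : Matrix n n ℂ}, IsSelfAdjoint C →
        ‖NormedSpace.exp ((m : ℝ)⁻¹ • C)‖ ≤ Real.exp ((m : ℝ)⁻¹ * ‖C‖) := by
      intro C hC
      refine (norm_exp_le_of_isSelfAdjoint ((IsSelfAdjoint.all _).smul hC)).trans ?_
      rw [norm_smul, Real.norm_of_nonneg (by positivity)]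
    have hX : ‖NormedSpace.exp ((m : ℝ)⁻¹ • A) * NormedSpace.exp ((m : ℝ)⁻¹ • B)‖ ≤
        Real.exp ((m : ℝ)⁻¹ * (‖A‖ + ‖B‖)) := by
      rw [mul_add, Real.exp_add]
      exact (norm_mul_le _ _).trans (mul_le_mul (hs hA) (hs hB) (norm_nonneg _) (Real.exp_nonneg _))
    have hY : ‖NormedSpace.exp ((m : ℝ)⁻¹ • (A + B))‖ ≤ Real.exp ((m : ℝ)⁻¹ * (‖A‖ + ‖B‖)) := by
      refine (hs (hA.add hB)).trans (Real.exp_le_exp.2 ?_)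
      gcongr
      exact norm_add_le _ _
    rw [e]
    refine (norm_pow_sub_pow_le hX hY m).trans ?_
    have : Real.exp ((m : ℝ)⁻¹ * (‖A‖ + ‖B‖)) ^ (m - 1) ≤ c := by
      rw [← Real.exp_nat_mul]
      refine Real.exp_le_exp.2 ?_
      have h5 : ((m - 1 : ℕ) : ℝ) ≤ m := by exact_mod_cast Nat.sub_le m 1
      calc ((m - 1 : ℕ) : ℝ) * ((m : ℝ)⁻¹ * (‖A‖ + ‖B‖)) ≤ m * ((m : ℝ)⁻¹ * (‖A‖ + ‖B‖)) := by gcongr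
        _ = ‖A‖ + ‖B‖ := by field_simp
    calc _ ≤ m * c * ‖D ((m : ℝ)⁻¹)‖ := by gcongr
      _ = _ := by ring
  rw [tendsto_iff_norm_sub_tendsto_zero]
  refine squeeze_zero' (Eventually.of_forall fun _ => norm_nonneg _)
    ((eventually_ge_atTop 1).mono hb) ?_
  simpa using hsl.const_mul c

/-- The Golden–Thompson inequality. -/
theorem trace_exp_add_le {A B : Matrix n n ℂ} (hA : IsSelfAdjoint A) (hB : IsSelfAdjoint B) :
    (NormedSpace.exp (A + B)).trace.re ≤ (NormedSpace.exp A * NormedSpace.exp B).trace.re := by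
  -- The trace inequality is available for exponents that are powers of two, so the Trotter limit is
  -- taken along that subsequence.
  have ht : Tendsto (fun k : ℕ => 2 ^ k) atTop (atTop : Filter ℕ) :=
    tendsto_pow_atTop_atTop_of_one_lt one_lt_two
  have hcont : Continuous fun X : Matrix n n ℂ => X.trace.re :=
    Complex.continuous_re.comp (Continuous.matrix_trace continuous_id)
  refine le_of_tendsto ((hcont.tendsto _).comp ((tendsto_trotter hA hB).comp ht))
    (Eventually.of_forall fun k => ?_)
  have hs : ∀ {C : Matrix n n ℂ}, NormedSpace.exp C =
      NormedSpace.exp (((2 ^ k : ℕ) : ℝ)⁻¹ • C) ^ 2 ^ k := by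
    intro C
    have hm0 : (0 : ℝ) < ((2 ^ k : ℕ) : ℝ) := by positivity
    rw [← Matrix.exp_nsmul, ← Nat.cast_smul_eq_nsmul ℝ, smul_smul, mul_inv_cancel₀ hm0.ne',
        one_smul]
  rw [hs (C := A), hs (C := B)]
  refine (Complex.re_le_norm _).trans ((trace_pow_inequalities k).2 _ _ ?_ ?_)
  · exact ((IsSelfAdjoint.all _).smul hA).exp_nonneg
  · exact ((IsSelfAdjoint.all _).smul hB).exp_nonneg

end Trotter

/-- The right side is the chord of the convex function exp over [-L, L]. For L = 0 the quotient is 0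
by convention and t = 0. -/
theorem exp_le_cosh_add {L t : ℝ} (ht : |t| ≤ L) :
    Real.exp t ≤ Real.cosh L + Real.sinh L / L * t := by
  obtain ⟨h1, h2⟩ := abs_le.1 ht
  rcases (abs_nonneg t |>.trans ht).eq_or_lt with h0 | h0
  · subst h0
    have : t = 0 := by linarith
    simp [this]
  · have hc := convexOn_exp.2 (Set.mem_univ (-L)) (Set.mem_univ L)
      (div_nonneg (by linarith : 0 ≤ L - t) (by positivity : 0 ≤ 2 * L))
      (div_nonneg (by linarith : 0 ≤ L + t) (by positivity : 0 ≤ 2 * L)) (by field_simp; ring)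
    have e : ((L - t) / (2 * L)) • (-L) + ((L + t) / (2 * L)) • L = t := by
      simp only [smul_eq_mul]; field_simp; ring
    rw [e] at hc
    refine hc.trans (le_of_eq ?_)
    rw [Real.cosh_eq, Real.sinh_eq]
    simp only [smul_eq_mul]
    field_simp; ring

/-! ### Operator bounds on exponentials -/

section ExpBounds

variable {n : Type*} [Fintype n] [DecidableEq n] [Nonempty n]

theorem exp_le_cosh_smul_add {D : Matrix n n ℂ} (hD : IsSelfAdjoint D) {L : ℝ} (hL : ‖D‖ ≤ L) :
    NormedSpace.exp D ≤ algebraMap ℝ _ (Real.cosh L) + (Real.sinh L / L) • D := by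
  have e : cfc (fun t : ℝ => Real.cosh L + Real.sinh L / L * t) D =
      algebraMap ℝ _ (Real.cosh L) + (Real.sinh L / L) • D := by
    rw [cfc_const_add (Real.cosh L) (fun t => Real.sinh L / L * t) D, cfc_const_mul_id _ D]
  rw [← CFC.real_exp_eq_normedSpace_exp hD, ← e]
  refine cfc_mono fun t ht => exp_le_cosh_add ?_
  exact (spectrum.norm_le_norm_of_mem ht).trans hL

/-- A noncommutative Hoeffding lemma: after Golden–Thompson and the chord bound on e^D, the centring
hypothesis removes the linear term and leaves cosh L ≤ e^{L²/2}. -/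
theorem trace_exp_add_le_of_trace_eq_zero {A D : Matrix n n ℂ} (hA : IsSelfAdjoint A)
    (hD : IsSelfAdjoint D) {L : ℝ} (hL : ‖D‖ ≤ L) (h0 : (NormedSpace.exp A * D).trace = 0) :
    (NormedSpace.exp (A + D)).trace.re ≤ (NormedSpace.exp A).trace.re * Real.exp (L ^ 2 / 2) := by
  have h1 := trace_mul_le hA.exp_nonneg (exp_le_cosh_smul_add hD hL)
  have h2 : 0 ≤ (NormedSpace.exp A).trace.re :=
    (Complex.le_def.1 (Matrix.nonneg_iff_posSemidef.1 hA.exp_nonneg).trace_nonneg).1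
  refine (trace_exp_add_le hA hD).trans (h1.trans ?_)
  rw [mul_add, Matrix.trace_add, mul_smul_comm, Matrix.trace_smul, h0, smul_zero, add_zero,
    Algebra.algebraMap_eq_smul_one, mul_smul_comm, mul_one, Matrix.trace_smul, Complex.smul_re,
    smul_eq_mul, mul_comm]
  exact mul_le_mul_of_nonneg_left (Real.cosh_le_exp_half_sq L) h2

theorem trace_exp_pos {A : Matrix n n ℂ} (hA : IsSelfAdjoint A) :
    0 < (NormedSpace.exp A).trace.re := by
  have h : algebraMap ℝ (Matrix n n ℂ) (Real.exp (-‖A‖)) ≤ NormedSpace.exp A := by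
    rw [← CFC.real_exp_eq_normedSpace_exp hA, ← cfc_const _ A]
    refine cfc_mono fun t ht => Real.exp_le_exp.2 ?_
    exact (abs_le.1 (spectrum.norm_le_norm_of_mem ht)).1
  have h1 := trace_mul_le (P := 1) (Matrix.PosSemidef.one.nonneg) h
  rw [one_mul, one_mul, Algebra.algebraMap_eq_smul_one, Matrix.trace_smul, Complex.smul_re,
    Matrix.trace_one] at h1
  refine lt_of_lt_of_le ?_ h1
  have : 0 < Fintype.card n := Fintype.card_pos
  simp only [Complex.natCast_re, smul_eq_mul]
  positivity

/-- Golden–Thompson bounds Tr e^A by Tr(e^B e^{A-B}), and e^{A-B} ≤ e^{‖A-B‖}. Later this removes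
the interaction between two regions. -/
theorem log_trace_exp_le_add_norm {A B : Matrix n n ℂ} (hA : IsSelfAdjoint A)
    (hB : IsSelfAdjoint B) :
    Real.log (NormedSpace.exp A).trace.re ≤ Real.log (NormedSpace.exp B).trace.re + ‖A - B‖ := by
  have hW := hA.sub hB
  have h1 : NormedSpace.exp (A - B) ≤ algebraMap ℝ _ (Real.exp ‖A - B‖) := by
    refine (IsSelfAdjoint.le_algebraMap_norm_self (IsSelfAdjoint.of_nonneg hW.exp_nonneg)).trans ?_
    exact algebraMap_mono _ (norm_exp_le_of_isSelfAdjoint hW)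
  have h2 := (trace_exp_add_le hB hW).trans (trace_mul_le hB.exp_nonneg h1)
  rw [add_sub_cancel, Algebra.algebraMap_eq_smul_one, mul_smul_comm, mul_one, Matrix.trace_smul,
    Complex.smul_re, smul_eq_mul] at h2
  have h3 := Real.log_le_log (trace_exp_pos hA) h2
  rwa [Real.log_mul (Real.exp_pos _).ne' (trace_exp_pos hB).ne', Real.log_exp, add_comm] at h3

end ExpBounds

/-! ### Averaging over one site -/

section SiteAvg

variable {I : Type*} [Fintype I] [DecidableEq I] {q : ℕ}

/-- The matrix unit `e_{jk}` acting on the site `x`. -/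
def siteUnit (x : I) (j k : Fin q) : Matrix (I → Fin q) (I → Fin q) ℂ :=
  Matrix.of fun s t => if s x = j ∧ t = Function.update s x k then 1 else 0

theorem siteUnit_mul_apply (x : I) (j k : Fin q) (A : Matrix (I → Fin q) (I → Fin q) ℂ)
    (s t : I → Fin q) :
    (siteUnit x j k * A) s t = if s x = j then A (Function.update s x k) t else 0 := by
  rw [Matrix.mul_apply]
  simp only [siteUnit, Matrix.of_apply, ite_and, ite_mul, one_mul, zero_mul]
  split_ifs <;> simp

theorem conjTranspose_siteUnit (x : I) (j k : Fin q) :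
    (siteUnit x j k).conjTranspose = siteUnit x k j := by
  ext s t
  simp only [Matrix.conjTranspose_apply, siteUnit, Matrix.of_apply]
  rw [apply_ite star, star_one, star_zero]
  refine if_congr ?_ rfl rfl
  constructor
  · rintro ⟨rfl, rfl⟩; simp
  · rintro ⟨rfl, rfl⟩; simp

theorem mul_siteUnit_apply (x : I) (j k : Fin q) (A : Matrix (I → Fin q) (I → Fin q) ℂ)
    (s t : I → Fin q) :
    (A * siteUnit x j k) s t = if t x = k then A s (Function.update t x j) else 0 := by
  have h : A * siteUnit x j k = (siteUnit x k j * A.conjTranspose).conjTranspose := by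
    rw [Matrix.conjTranspose_mul, conjTranspose_siteUnit, Matrix.conjTranspose_conjTranspose]
  rw [h, Matrix.conjTranspose_apply, siteUnit_mul_apply]
  split_ifs <;> simp

/-- The normalized partial trace over the site `x`, tensored with the identity on that site. -/
noncomputable def siteAvg (x : I) :
    Matrix (I → Fin q) (I → Fin q) ℂ →ₗ[ℂ] Matrix (I → Fin q) (I → Fin q) ℂ where
  toFun A := (q : ℂ)⁻¹ • ∑ j, ∑ k, siteUnit x j k * A * (siteUnit x j k).conjTranspose
  map_add' A B := by
    simp only [mul_add, add_mul, Finset.sum_add_distrib, smul_add]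
  map_smul' c A := by
    simp only [mul_smul_comm, smul_mul_assoc, ← Finset.smul_sum, RingHom.id_apply]
    rw [smul_comm]

theorem siteAvg_def (x : I) (A : Matrix (I → Fin q) (I → Fin q) ℂ) :
    siteAvg x A = (q : ℂ)⁻¹ • ∑ j, ∑ k, siteUnit x j k * A * (siteUnit x j k).conjTranspose := rfl

theorem siteAvg_apply (x : I) (A : Matrix (I → Fin q) (I → Fin q) ℂ) (s t : I → Fin q) :
    siteAvg x A s t = if s x = t x then
      (q : ℂ)⁻¹ * ∑ k, A (Function.update s x k) (Function.update t x k) else 0 := by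
  rw [siteAvg_def, Matrix.smul_apply, Matrix.sum_apply]
  simp only [Matrix.sum_apply, conjTranspose_siteUnit, mul_siteUnit_apply, siteUnit_mul_apply]
  by_cases h : s x = t x
  · rw [if_pos h, smul_eq_mul, Finset.sum_comm]
    congr 1
    refine Finset.sum_congr rfl fun k _ => ?_
    simp [h]
  · rw [if_neg h]
    have : ∀ j k : Fin q, (if t x = j then if s x = j then
        A (Function.update s x k) (Function.update t x k) else 0 else 0) = 0 := by
      intro j k
      split_ifs with h1 h2
      · exact absurd (h2.trans h1.symm) h
      · rfl
      · rfl
    simp [this]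

theorem siteAvg_comm (x y : I) (A : Matrix (I → Fin q) (I → Fin q) ℂ) :
    siteAvg x (siteAvg y A) = siteAvg y (siteAvg x A) := by
  by_cases hxy : x = y
  · rw [hxy]
  ext s t
  simp only [siteAvg_apply, Function.update_of_ne hxy, Function.update_of_ne (Ne.symm hxy)]
  by_cases h1 : s x = t x <;> by_cases h2 : s y = t y <;> simp [h1, h2]
  left
  rw [← Finset.mul_sum, ← Finset.mul_sum, Finset.sum_comm]
  simp only [Function.update_comm hxy]

/-- The average acts as the identity on the factor at x, so it lies in the commutant of that factor;
its exponential then does too, which makes A - E_x A centred. -/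
theorem commute_siteUnit_siteAvg (x : I) (j k : Fin q) (A : Matrix (I → Fin q) (I → Fin q) ℂ) :
    Commute (siteUnit x j k) (siteAvg x A) := by
  ext s t
  rw [siteUnit_mul_apply, mul_siteUnit_apply, siteAvg_apply, siteAvg_apply]
  simp only [Function.update_self, Function.update_idem]
  simp only [eq_comm (a := k)]
  by_cases h1 : s x = j <;> by_cases h2 : t x = k <;> simp [h1, h2]

theorem sum_siteUnit_mul_siteUnit (x : I) :
    ∑ j : Fin q, ∑ k : Fin q, siteUnit x k j * siteUnit x j k =
      (q : ℂ) • (1 : Matrix (I → Fin q) (I → Fin q) ℂ) := by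
  have h : ∀ j : Fin q, ∑ k : Fin q, siteUnit x k j * siteUnit x j k =
      (1 : Matrix (I → Fin q) (I → Fin q) ℂ) := by
    intro j
    ext s t
    rw [Matrix.sum_apply]
    simp only [siteUnit_mul_apply]
    simp [siteUnit, Matrix.one_apply, eq_comm]
  simp [h, Matrix.smul_one_eq_diagonal, ← Matrix.diagonal_natCast]

theorem siteAvg_nonneg (x : I) {A : Matrix (I → Fin q) (I → Fin q) ℂ} (hA : 0 ≤ A) :
    0 ≤ siteAvg x A := by
  rw [siteAvg_def]
  refine smul_nonneg (by positivity) (Finset.sum_nonneg fun j _ => Finset.sum_nonneg fun k _ => ?_)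
  exact ((Matrix.nonneg_iff_posSemidef.1 hA).mul_mul_conjTranspose_same _).nonneg

theorem isSelfAdjoint_siteAvg (x : I) {A : Matrix (I → Fin q) (I → Fin q) ℂ}
    (hA : IsSelfAdjoint A) : IsSelfAdjoint (siteAvg x A) := by
  rw [siteAvg_def]
  refine IsSelfAdjoint.smul (by simp [IsSelfAdjoint]) ?_
  refine isSelfAdjoint_sum _ fun j _ => isSelfAdjoint_sum _ fun k _ => ?_
  exact hA.conjugate _

variable [NeZero q]

theorem siteAvg_idem (x : I) (A : Matrix (I → Fin q) (I → Fin q) ℂ) :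
    siteAvg x (siteAvg x A) = siteAvg x A := by
  have hq : (q : ℂ) ≠ 0 := Nat.cast_ne_zero.2 (NeZero.ne q)
  ext s t
  simp only [siteAvg_apply, Function.update_self, Function.update_idem, if_true, Finset.sum_const,
    Finset.card_univ, Fintype.card_fin, nsmul_eq_mul]
  rw [mul_inv_cancel_left₀ hq]

theorem siteAvg_one (x : I) : siteAvg x (1 : Matrix (I → Fin q) (I → Fin q) ℂ) = 1 := by
  have hq : (q : ℂ) ≠ 0 := Nat.cast_ne_zero.2 (NeZero.ne q)
  ext s t
  rw [siteAvg_apply, Matrix.one_apply]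
  by_cases hst : s = t
  · subst hst
    simp [hq]
  · rw [if_neg hst]
    split_ifs with h
    · refine mul_eq_zero_of_right _ (Finset.sum_eq_zero fun k _ => ?_)
      rw [Matrix.one_apply, if_neg]
      intro e
      refine hst (funext fun y => ?_)
      by_cases hy : y = x
      · rw [hy, h]
      · simpa [hy] using congrFun e y
    · rfl

/-- The averaging is positive and unital, so it preserves -‖A‖ ≤ A ≤ ‖A‖; the norm of a self-adjoint
element is attained, up to sign, in its spectrum. -/
theorem norm_siteAvg_le (x : I) {A : Matrix (I → Fin q) (I → Fin q) ℂ}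
    (hA : IsSelfAdjoint A) : ‖siteAvg x A‖ ≤ ‖A‖ := by
  have hone : ∀ c : ℝ, siteAvg x (algebraMap ℝ (Matrix (I → Fin q) (I → Fin q) ℂ) c) =
      algebraMap ℝ _ c := by
    intro c
    rw [IsScalarTower.algebraMap_apply ℝ ℂ, Algebra.algebraMap_eq_smul_one, map_smul, siteAvg_one]
  have h1 := siteAvg_nonneg x (sub_nonneg.2 hA.le_algebraMap_norm_self)
  have h2 := siteAvg_nonneg x (sub_nonneg.2 hA.neg_algebraMap_norm_le_self)
  rw [map_sub, hone, sub_nonneg] at h1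
  rw [map_sub, map_neg, hone, sub_nonneg] at h2
  rcases CStarAlgebra.norm_or_neg_norm_mem_spectrum (isSelfAdjoint_siteAvg x hA) with h | h
  · exact (le_algebraMap_iff_spectrum_le (isSelfAdjoint_siteAvg x hA)).1 h1 _ h
  · rw [← map_neg] at h2
    have := (algebraMap_le_iff_le_spectrum (isSelfAdjoint_siteAvg x hA)).1 h2 _ h
    linarith

/-- An operator commuting with the matrix units can be moved past them under the trace. What is left
is ∑ e_{kj} e_{jk} = q, cancelled by the normalization. -/
theorem trace_mul_siteAvg (x : I) {P : Matrix (I → Fin q) (I → Fin q) ℂ}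
    (hP : ∀ j k, Commute (siteUnit x j k) P) (A : Matrix (I → Fin q) (I → Fin q) ℂ) :
    (P * siteAvg x A).trace = (P * A).trace := by
  have hq : (q : ℂ) ≠ 0 := Nat.cast_ne_zero.2 (NeZero.ne q)
  have h : ∀ j k, (P * (siteUnit x j k * A * (siteUnit x j k).conjTranspose)).trace =
      ((siteUnit x k j * siteUnit x j k) * (P * A)).trace := by
    intro j k
    rw [conjTranspose_siteUnit, ← mul_assoc, Matrix.trace_mul_comm, ← mul_assoc P, ← (hP j k).eq]
    simp only [mul_assoc]
  rw [siteAvg_def, mul_smul_comm, Matrix.trace_smul, Finset.mul_sum]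
  simp only [Finset.mul_sum, Matrix.trace_sum, h]
  simp only [← Matrix.trace_sum, ← Finset.sum_mul]
  rw [sum_siteUnit_mul_siteUnit, smul_mul_assoc, one_mul, Matrix.trace_smul, smul_smul,
    inv_mul_cancel₀ hq, one_smul]

theorem trace_siteAvg (x : I) (A : Matrix (I → Fin q) (I → Fin q) ℂ) :
    (siteAvg x A).trace = A.trace := by
  simpa using trace_mul_siteAvg x (P := 1) (fun _ _ => Commute.one_right _) A

theorem trace_exp_le_trace_exp_siteAvg (x : I) {A : Matrix (I → Fin q) (I → Fin q) ℂ}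
    (hA : IsSelfAdjoint A) {L : ℝ} (hL : ‖A - siteAvg x A‖ ≤ L) :
    (NormedSpace.exp A).trace.re ≤
      (NormedSpace.exp (siteAvg x A)).trace.re * Real.exp (L ^ 2 / 2) := by
  have hE := isSelfAdjoint_siteAvg x hA
  have h := trace_exp_add_le_of_trace_eq_zero hE (hA.sub hE) hL ?_
  · rwa [add_sub_cancel] at h
  · rw [mul_sub, Matrix.trace_sub, sub_eq_zero]
    exact (trace_mul_siteAvg x (fun j k => (commute_siteUnit_siteAvg x j k A).exp_right) A).symm

/-- An entry between two configurations that differ at x is killed by the average over x. Diagonal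
entries do not change when one coordinate is altered, and changing coordinates one by one connects
any two configurations. -/
theorem eq_smul_one_of_siteAvg_eq {A : Matrix (I → Fin q) (I → Fin q) ℂ}
    (h : ∀ x, siteAvg x A = A) :
    A = (A.trace / (q : ℂ) ^ Fintype.card I) • (1 : Matrix (I → Fin q) (I → Fin q) ℂ) := by
  have hq : (q : ℂ) ≠ 0 := Nat.cast_ne_zero.2 (NeZero.ne q)
  have hoff : ∀ s t, s ≠ t → A s t = 0 := by
    intro s t hst
    obtain ⟨x, hx⟩ := Function.ne_iff.1 hst
    rw [← h x, siteAvg_apply, if_neg hx]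
  have hup : ∀ s x k, A (Function.update s x k) (Function.update s x k) = A s s := by
    intro s x k
    rw [← h x, siteAvg_apply, siteAvg_apply]
    simp
  have hdiag : ∀ s t, A s s = A t t := by
    intro s t
    have key : ∀ S : Finset I, A (S.piecewise t s) (S.piecewise t s) = A s s := by
      intro S
      induction S using Finset.induction_on with
      | empty => simp
      | insert x S _ ih => rw [Finset.piecewise_insert, hup, ih]
    simpa using (key Finset.univ).symm
  have htr : ∀ s, A.trace = (q : ℂ) ^ Fintype.card I * A s s := by
    intro s
    rw [show A.trace = ∑ t, A t t from rfl, Finset.sum_congr rfl fun t _ => hdiag t s]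
    simp
  ext s t
  by_cases hst : s = t
  · subst hst
    rw [htr s]
    simp [hq]
  · simp [hoff s t hst, hst]

/-- Gaussian concentration for the normalized trace. -/
theorem trace_exp_le_of_norm_sub_siteAvg_le {A : Matrix (I → Fin q) (I → Fin q) ℂ}
    (hA : IsSelfAdjoint A) {L : I → ℝ} (hL : ∀ x, ‖A - siteAvg x A‖ ≤ L x) :
    (NormedSpace.exp A).trace.re ≤ (q : ℝ) ^ Fintype.card I *
      Real.exp ((A.trace / (q : ℂ) ^ Fintype.card I).re + ∑ x, L x ^ 2 / 2) := by
  -- K is A averaged over the sites of S. The induction must carry the bounds for all y, so that the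
  -- next site still costs at most its original L.
  have key : ∀ S : Finset I, ∃ K : Matrix (I → Fin q) (I → Fin q) ℂ, IsSelfAdjoint K ∧
      (∀ x ∈ S, siteAvg x K = K) ∧ K.trace = A.trace ∧ (∀ y, ‖K - siteAvg y K‖ ≤ L y) ∧
      (NormedSpace.exp A).trace.re ≤
        (NormedSpace.exp K).trace.re * Real.exp (∑ x ∈ S, L x ^ 2 / 2) := by
    intro S
    induction S using Finset.induction_on with
    | empty => exact ⟨A, hA, by simp, rfl, hL, by simp⟩
    | insert x S hx ih =>
      obtain ⟨K, h1, h2, h3, h4, h5⟩ := ih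
      refine ⟨siteAvg x K, isSelfAdjoint_siteAvg x h1, fun y hy => ?_, ?_, fun y => ?_, ?_⟩
      · rcases Finset.mem_insert.1 hy with rfl | hy
        · exact siteAvg_idem _ _
        · rw [siteAvg_comm, h2 y hy]
      · rw [trace_siteAvg, h3]
      · rw [siteAvg_comm, ← map_sub]
        exact (norm_siteAvg_le x (h1.sub (isSelfAdjoint_siteAvg y h1))).trans (h4 y)
      · refine h5.trans ?_
        rw [Finset.sum_insert hx, Real.exp_add, ← mul_assoc]
        exact mul_le_mul_of_nonneg_right (trace_exp_le_trace_exp_siteAvg x h1 (h4 x))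
          (Real.exp_nonneg _)
  obtain ⟨K, h1, h2, h3, -, h5⟩ := key Finset.univ
  refine h5.trans (le_of_eq ?_)
  have hK := eq_smul_one_of_siteAvg_eq fun x => h2 x (Finset.mem_univ x)
  rw [h3] at hK
  set c := A.trace / (q : ℂ) ^ Fintype.card I with hc
  have hcr : ((c.re : ℝ) : ℂ) = c := by
    have h6 : star A.trace = A.trace := by
      rw [← Matrix.trace_conjTranspose]; exact congrArg _ hA.star_eq
    apply Complex.conj_eq_iff_re.1
    rw [hc, map_div₀, map_pow, Complex.conj_natCast]
    exact congrArg (· / _) h6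
  have h7 : NormedSpace.exp K = Complex.exp c • (1 : Matrix (I → Fin q) (I → Fin q) ℂ) := by
    rw [hK, ← Algebra.algebraMap_eq_smul_one, ← Algebra.algebraMap_eq_smul_one,
      Complex.exp_eq_exp_ℂ, NormedSpace.algebraMap_exp_comm]
  rw [h7, Matrix.trace_smul, Matrix.trace_one, ← hcr, ← Complex.ofReal_exp, Real.exp_add]
  simp [Fintype.card_pi]
  norm_cast
  ring

end SiteAvg

/-! ### Inclusions, translations and averages over a site -/

section Lattice

variable {d q : ℕ}

theorem siteAvg_embed_of_mem {Λ Λ' : Finset (Site d)} (h : Λ ≤ Λ') {x : Site d} (hx : x ∈ Λ)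
    (A : Alg q Λ) :
    siteAvg (⟨x, h hx⟩ : Λ') (embed q h A) = embed q h (siteAvg (⟨x, hx⟩ : Λ) A) := by
  have hup : ∀ (s : Config q Λ') (k : Fin q),
      (fun y : Λ => Function.update s (⟨x, h hx⟩ : Λ') k ⟨y.1, h y.2⟩) =
        Function.update (fun y : Λ => s ⟨y.1, h y.2⟩) ⟨x, hx⟩ k := by
    intro s k
    funext y
    by_cases hy : y = ⟨x, hx⟩
    · subst hy; simp
    · have : (⟨y.1, h y.2⟩ : Λ') ≠ ⟨x, h hx⟩ := fun e => hy (Subtype.ext (congrArg (·.1) e))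
      simp [hy, this]
  have hoff : ∀ (s : Config q Λ') (k : Fin q) (y : Λ'), y.1 ∉ Λ →
      Function.update s (⟨x, h hx⟩ : Λ') k y = s y := by
    intro s k y hy
    refine Function.update_of_ne (fun e => hy ?_) _ _
    rw [e]; exact hx
  ext s t
  simp only [siteAvg_apply, embed_apply, hup]
  have hc : ∀ k, (∀ y : Λ', y.1 ∉ Λ → Function.update s (⟨x, h hx⟩ : Λ') k y =
      Function.update t (⟨x, h hx⟩ : Λ') k y) ↔ ∀ y : Λ', y.1 ∉ Λ → s y = t y := fun k =>
    forall₂_congr fun y hy => by rw [hoff s k y hy, hoff t k y hy]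
  simp only [hc, ← Finset.sum_mul, ite_mul, zero_mul, mul_assoc]

theorem siteAvg_embed_of_notMem [NeZero q] {Λ Λ' : Finset (Site d)} (h : Λ ≤ Λ') {x : Site d}
    (hx : x ∉ Λ) (hx' : x ∈ Λ') (A : Alg q Λ) :
    siteAvg (⟨x, hx'⟩ : Λ') (embed q h A) = embed q h A := by
  have hq : (q : ℂ) ≠ 0 := Nat.cast_ne_zero.2 (NeZero.ne q)
  ext s t
  rw [siteAvg_apply]
  by_cases hst : s ⟨x, hx'⟩ = t ⟨x, hx'⟩
  · rw [if_pos hst]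
    have : ∀ k, embed q h A (Function.update s ⟨x, hx'⟩ k) (Function.update t ⟨x, hx'⟩ k) =
        embed q h A s t := by
      intro k
      have hup : ∀ (s : Config q Λ'), (fun y : Λ => Function.update s (⟨x, hx'⟩ : Λ') k
          ⟨y.1, h y.2⟩) = fun y : Λ => s ⟨y.1, h y.2⟩ := by
        intro s
        funext y
        refine Function.update_of_ne (fun e => hx ?_) _ _
        have e' : y.1 = x := congrArg Subtype.val e
        exact e' ▸ y.2
      rw [embed_apply, embed_apply, hup, hup]
      congr 1
      refine if_congr (forall₂_congr fun y _ => ?_) rfl rfl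
      by_cases hy : y = ⟨x, hx'⟩
      · subst hy; simp [hst]
      · simp [hy]
    simp [this, hq]
  · rw [if_neg hst, embed_apply, if_neg, mul_zero]
    exact fun e => hst (e ⟨x, hx'⟩ hx)

/-- Configurations on `Λ + x` are configurations on `Λ`. -/
def shiftConfig (q : ℕ) (x : Site d) (Λ : Finset (Site d)) :
    Config q (shift x Λ) ≃ Config q Λ where
  toFun s y := s ⟨y.1 + x, add_mem_shift x y.2⟩
  invFun s y := s ⟨y.1 - x, by
    obtain ⟨z, hz, e⟩ := Finset.mem_map.1 y.2
    rw [← e]; simpa using hz⟩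
  left_inv s := by funext y; simp
  right_inv s := by funext y; simp

theorem translate_eq (x : Site d) (Λ : Finset (Site d)) (A : Alg q Λ) :
    translate x Λ A = A.submatrix (shiftConfig q x Λ) (shiftConfig q x Λ) := rfl

/-- The translation as a homomorphism of star algebras. -/
def translateHom (q : ℕ) (x : Site d) (Λ : Finset (Site d)) :
    Alg q Λ →⋆ₐ[ℂ] Alg q (shift x Λ) where
  toFun := translate x Λ
  map_one' := by simp [translate_eq]
  map_mul' A B := by simp [translate_eq, Matrix.submatrix_mul_equiv]
  map_zero' := by simp [translate_eq]
  map_add' A B := rfl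
  commutes' c := by
    simp [translate_eq, Algebra.algebraMap_eq_smul_one, Matrix.submatrix_smul]
  map_star' A := by
    simp [translate_eq, Matrix.star_eq_conjTranspose, Matrix.conjTranspose_submatrix]

theorem translateHom_apply (x : Site d) (Λ : Finset (Site d)) (A : Alg q Λ) :
    translateHom q x Λ A = translate x Λ A := rfl

theorem norm_translateHom (x : Site d) (Λ : Finset (Site d)) (A : Alg q Λ) :
    ‖translateHom q x Λ A‖ = ‖A‖ := by
  refine NonUnitalStarAlgHom.norm_map (translateHom q x Λ) (fun A B h => ?_) A
  have h' := congrArg (fun C => C.submatrix (shiftConfig q x Λ).symm (shiftConfig q x Λ).symm) h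
  simpa [translateHom_apply, translate_eq] using h'

theorem trace_translateHom (x : Site d) (Λ : Finset (Site d)) (A : Alg q Λ) :
    (translateHom q x Λ A).trace = A.trace :=
  (shiftConfig q x Λ).sum_comp fun s => A s s

theorem card_shift (x : Site d) (Λ : Finset (Site d)) : (shift x Λ).card = Λ.card :=
  Finset.card_map _

theorem mem_shift {x y : Site d} {Λ : Finset (Site d)} : y ∈ shift x Λ ↔ y - x ∈ Λ := by
  constructor
  · intro h
    obtain ⟨z, hz, rfl⟩ := Finset.mem_map.1 h
    simpa using hz
  · intro h
    simpa using add_mem_shift x h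

theorem shift_shift (x y : Site d) (Λ : Finset (Site d)) :
    shift x (shift y Λ) = shift (y + x) Λ := by
  ext z
  simp only [mem_shift]
  rw [show z - x - y = z - (y + x) by abel]

theorem shift_zero (Λ : Finset (Site d)) : shift 0 Λ = Λ := by
  ext z
  simp [mem_shift]

theorem shift_subset_iff {x : Site d} {X Λ : Finset (Site d)} : shift x X ⊆ shift x Λ ↔ X ⊆ Λ :=
  Finset.map_subset_map

theorem embed_translate (x : Site d) {X Λ : Finset (Site d)} (h : X ≤ Λ)
    (h' : shift x X ≤ shift x Λ) (A : Alg q X) :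
    embed q h' (translate x X A) = translate x Λ (embed q h A) := by
  ext s t
  rw [embed_apply, translate_eq, translate_eq, Matrix.submatrix_apply, Matrix.submatrix_apply,
    embed_apply]
  congr 1
  refine if_congr ?_ rfl rfl
  constructor
  · intro e y hy
    exact e ⟨y.1 + x, add_mem_shift x y.2⟩ (by simpa [mem_shift] using hy)
  · intro e y hy
    have h1 : y.1 - x ∈ Λ := mem_shift.1 y.2
    have := e ⟨y.1 - x, h1⟩ (fun h2 => hy (mem_shift.2 h2))
    simpa [shiftConfig] using this

theorem siteAvg_translate (x : Site d) {Λ : Finset (Site d)} (y : Λ) (A : Alg q Λ) :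
    siteAvg (⟨y.1 + x, add_mem_shift x y.2⟩ : shift x Λ) (translate x Λ A) =
      translate x Λ (siteAvg y A) := by
  have hup : ∀ (s : Config q (shift x Λ)) (k : Fin q),
      shiftConfig q x Λ (Function.update s ⟨y.1 + x, add_mem_shift x y.2⟩ k) =
        Function.update (shiftConfig q x Λ s) y k := by
    intro s k
    funext z
    by_cases hz : z = y
    · subst hz; simp [shiftConfig]
    · have : z.1 ≠ y.1 := fun e => hz (Subtype.ext e)
      simp [shiftConfig, hz, this]
  ext s t
  simp only [siteAvg_apply, translate_eq, Matrix.submatrix_apply, hup]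
  rfl

namespace Interaction

variable {Φ : Interaction d q}

theorem isSelfAdjoint_hamiltonian (Φ : Interaction d q) (Λ : Finset (Site d)) :
    IsSelfAdjoint (Φ.hamiltonian Λ) :=
  isSelfAdjoint_sum _ fun X _ => (Φ.selfAdjoint X.1).map (embed q (Finset.mem_powerset.1 X.2))

theorem hamiltonian_shift (hΦ : Φ.TranslationInvariant) (x : Site d) (Λ : Finset (Site d)) :
    Φ.hamiltonian (shift x Λ) = translateHom q x Λ (Φ.hamiltonian Λ) := by
  rw [hamiltonian, hamiltonian, map_sum]
  symm
  refine Fintype.sum_bijective (fun X : {X : Finset (Site d) // X ∈ Λ.powerset} =>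
    (⟨shift x X.1, Finset.mem_powerset.2 (shift_subset_iff.2 (Finset.mem_powerset.1 X.2))⟩ :
      {X : Finset (Site d) // X ∈ (shift x Λ).powerset})) ⟨?_, ?_⟩ _ _ fun X => ?_
  · intro X Y h
    exact Subtype.ext (Finset.map_injective _ (congrArg (·.1) h))
  · intro Y
    have e : shift x (shift (-x) Y.1) = Y.1 := by rw [shift_shift, neg_add_cancel, shift_zero]
    refine ⟨⟨shift (-x) Y.1, Finset.mem_powerset.2 ?_⟩, Subtype.ext e⟩
    rw [← shift_subset_iff (x := x), e]
    exact Finset.mem_powerset.1 Y.2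
  · simp only [hΦ X.1 x]
    exact (embed_translate x _ _ _).symm

end Interaction

variable [NeZero q]

theorem incl_embed {Λ Λ' : Finset (Site d)} (h : Λ ≤ Λ') (A : Alg q Λ) :
    incl Λ' (embed q h A) = incl Λ A := by
  rw [incl_apply, incl_apply, LocalAlg.mk_embed]

theorem incl_star (Λ : Finset (Site d)) (A : Alg q Λ) : incl Λ (star A) = star (incl Λ A) := by
  rw [incl_apply, incl_apply, LocalAlg.mk_star, coe_star]

theorem norm_embed_sub_embed {Λ Λ₁ Λ₂ : Finset (Site d)} (h₁ : Λ₁ ≤ Λ) (h₂ : Λ₂ ≤ Λ) (A : Alg q Λ₁)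
    (B : Alg q Λ₂) : ‖embed q h₁ A - embed q h₂ B‖ = ‖incl Λ₁ A - incl Λ₂ B‖ := by
  rw [← norm_incl, map_sub, incl_embed, incl_embed]

/-- The difference of a self-adjoint operator with its average over a site is controlled by its
distance to the operators that do not act on that site. -/
theorem norm_sub_siteAvg_le {Λ Y : Finset (Site d)} {x : Site d} (hx : x ∈ Λ) (hxY : x ∉ Y)
    {S : Alg q Λ} (hS : IsSelfAdjoint S) (B : Alg q Y) :
    ‖S - siteAvg (⟨x, hx⟩ : Λ) S‖ ≤ 2 * ‖incl Λ S - incl Y B‖ := by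
  -- The approximant B may fail to be self-adjoint, while contractivity of the average is known for
  -- self-adjoint operators. The self-adjoint part of B is no farther from S.
  set B' : Alg q Y := (2 : ℂ)⁻¹ • (B + star B) with hB'
  have hB's : IsSelfAdjoint B' := by
    refine IsSelfAdjoint.smul (by simp [IsSelfAdjoint]) (IsSelfAdjoint.add_star_self B)
  have h1 : ‖incl Λ S - incl Y B'‖ ≤ ‖incl Λ S - incl Y B‖ := by
    have e : incl Λ S - incl Y B' =
        (2 : ℂ)⁻¹ • ((incl Λ S - incl Y B) + star (incl Λ S - incl Y B)) := by
      rw [star_sub, ← incl_star, ← incl_star, hS.star_eq, hB', map_smul, map_add]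
      module
    have hst : ‖star (incl Λ S - incl Y B)‖ = ‖incl Λ S - incl Y B‖ := by
      have hΛ : Λ ≤ Λ ∪ Y := Finset.subset_union_left
      have hY : Y ≤ Λ ∪ Y := Finset.subset_union_right
      rw [← incl_embed hΛ, ← incl_embed hY, ← map_sub, ← incl_star, norm_incl, norm_incl, norm_star]
    rw [e, norm_smul]
    have := norm_add_le (incl Λ S - incl Y B) (star (incl Λ S - incl Y B))
    rw [hst] at this
    have h2 : ‖(2 : ℂ)⁻¹‖ = 2⁻¹ := by simp
    rw [h2]
    linarith
  have hΛ : Λ ≤ Λ ∪ Y := Finset.subset_union_left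
  have hY : Y ≤ Λ ∪ Y := Finset.subset_union_right
  set T := embed q hΛ S - embed q hY B' with hT
  have hTs : IsSelfAdjoint T := (hS.map (embed q hΛ)).sub (hB's.map (embed q hY))
  -- The average over x fixes B', so subtracting B' does not change the deviation from the average;
  -- the deviation of T has norm at most 2‖T‖.
  have e2 : embed q hΛ (S - siteAvg (⟨x, hx⟩ : Λ) S) = T - siteAvg (⟨x, hΛ hx⟩ : (Λ ∪ Y : Finset _)) T := by
    rw [hT, map_sub, map_sub, siteAvg_embed_of_mem hΛ hx, siteAvg_embed_of_notMem hY hxY]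
    abel
  rw [← norm_embed hΛ, e2]
  have h3 := norm_siteAvg_le (⟨x, hΛ hx⟩ : (Λ ∪ Y : Finset _)) hTs
  have h4 : ‖T‖ = ‖incl Λ S - incl Y B'‖ := norm_embed_sub_embed hΛ hY S B'
  have h5 := norm_sub_le T (siteAvg (⟨x, hΛ hx⟩ : (Λ ∪ Y : Finset _)) T)
  linarith

/-- Stated for a general Banach-space-valued g because it serves twice: for the observables
themselves and for their expectations weighted by 1/|X|. -/
theorem tsum_sub_sum_le {E : Type*} [NormedAddCommGroup E] [CompleteSpace E]
    {g : Finset (Site d) → E} {b : Finset (Site d) → ℝ} (hg : ∀ X, ‖g X‖ ≤ b X)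
    (hb : Summable fun X : {X : Finset (Site d) // (0 : Site d) ∈ X} => b X.1)
    (Γ : Finset (Site d)) :
    ‖(∑' X : {X : Finset (Site d) // (0 : Site d) ∈ X}, g X.1) -
        ∑ X ∈ Γ.powerset with (0 : Site d) ∈ X, g X‖ ≤
      ∑' X : {X : Finset (Site d) // (0 : Site d) ∈ X}, if X.1 ⊆ Γ then 0 else b X.1 := by
  have hb0 : ∀ X, 0 ≤ b X := fun X => (norm_nonneg _).trans (hg X)
  have hgs : Summable fun X : {X : Finset (Site d) // (0 : Site d) ∈ X} => g X.1 :=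
    Summable.of_norm_bounded hb fun X => hg X.1
  set S : Finset {X : Finset (Site d) // (0 : Site d) ∈ X} := Γ.powerset.subtype _ with hS
  have e : ∑ X ∈ Γ.powerset with (0 : Site d) ∈ X, g X =
      ∑' X : {X : Finset (Site d) // (0 : Site d) ∈ X}, if X.1 ⊆ Γ then g X.1 else 0 := by
    rw [tsum_eq_sum (s := S)]
    · rw [← Finset.sum_subtype_eq_sum_filter]
      refine Finset.sum_congr rfl fun X hX => ?_
      rw [if_pos]
      simpa [hS] using hX
    · intro X hX
      rw [if_neg]
      simpa [hS] using hX
  have hs2 : Summable fun X : {X : Finset (Site d) // (0 : Site d) ∈ X} =>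
      if X.1 ⊆ Γ then g X.1 else 0 := by
    refine Summable.of_norm_bounded hb fun X => ?_
    split_ifs
    · exact hg X.1
    · simpa using hb0 X.1
  rw [e, ← hgs.tsum_sub hs2]
  refine tsum_of_norm_bounded (Summable.hasSum ?_) fun X => ?_
  · refine Summable.of_nonneg_of_le (fun X => ?_) (fun X => ?_) hb
    · split_ifs
      · exact le_rfl
      · exact hb0 X.1
    · split_ifs
      · exact hb0 X.1
      · exact le_rfl
  · split_ifs
    · simp
    · simpa using hg X.1

/-! ### Dependence of the Hamiltonian on one site -/

namespace Interaction

/-- The total strength of the interaction terms that contain the origin and reach out of `Γ`. -/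
noncomputable def tail (Φ : Interaction d q) (Γ : Finset (Site d)) : ℝ :=
  ∑' X : {X : Finset (Site d) // (0 : Site d) ∈ X}, if X.1 ⊆ Γ then 0 else ‖Φ.toFun X.1‖

variable {Φ : Interaction d q}

/-- Terms avoiding the origin cancel in the difference. The sum S of the others lies within `tail`
of the full series W, and W is compared with a strictly local operator nearly realizing the infimum
in `lipschitz`. -/
theorem norm_hamiltonian_sub_siteAvg_zero_le
    (hΦ : Summable fun X : {X : Finset (Site d) // (0 : Site d) ∈ X} => ‖Φ.toFun X.1‖)
    {Γ : Finset (Site d)} (h0 : (0 : Site d) ∈ Γ) :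
    ‖Φ.hamiltonian Γ - siteAvg (⟨0, h0⟩ : Γ) (Φ.hamiltonian Γ)‖ ≤
      Φ.lipschitz + 2 * Φ.tail Γ := by
  refine le_of_forall_pos_le_add fun ε hε => ?_
  set W := ∑' X : {X : Finset (Site d) // (0 : Site d) ∈ X}, incl X.1 (Φ.toFun X.1) with hW
  have hne : Nonempty (regionObs (d := d) q {(0 : Site d)}ᶜ) :=
    ⟨⟨0, subset_closure (Set.mem_iUnion.2 ⟨⟨∅, by simp⟩, 0, map_zero _⟩), IsSelfAdjoint.zero _⟩⟩
  -- One ε/4 is spent on approaching the infimum and one on making A strictly local; the final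
  -- factor 2 turns them into ε.
  obtain ⟨A, hA⟩ := exists_lt_of_ciInf_lt (f := fun A : regionObs (d := d) q {(0 : Site d)}ᶜ =>
    ‖W - A.1‖) (lt_add_of_pos_right _ (show 0 < ε / 4 by positivity))
  have hlip : Φ.lipschitz = 2 * ⨅ A : regionObs (d := d) q {(0 : Site d)}ᶜ, ‖W - A.1‖ := rfl
  obtain ⟨C, hC, hAC⟩ := Metric.mem_closure_iff.1 A.2.1 (ε / 4) (by positivity)
  obtain ⟨⟨Y, hY⟩, B, rfl⟩ := Set.mem_iUnion.1 hC
  have h0Y : (0 : Site d) ∉ Y := fun h => hY h rfl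
  let S : Alg q Γ := ∑ X : {X : Finset (Site d) // X ∈ Γ.powerset},
    if (0 : Site d) ∈ X.1 then embed q (Finset.mem_powerset.1 X.2) (Φ.toFun X.1) else 0
  have hS : IsSelfAdjoint S := by
    refine isSelfAdjoint_sum _ fun X _ => ?_
    split_ifs
    · exact (Φ.selfAdjoint X.1).map (embed q (Finset.mem_powerset.1 X.2))
    · exact IsSelfAdjoint.zero _
  have hdiff : Φ.hamiltonian Γ - siteAvg (⟨0, h0⟩ : Γ) (Φ.hamiltonian Γ) =
      S - siteAvg (⟨0, h0⟩ : Γ) S := by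
    simp only [S, hamiltonian, map_sum, ← Finset.sum_sub_distrib]
    refine Finset.sum_congr rfl fun X _ => ?_
    split_ifs with h
    · rfl
    · rw [siteAvg_embed_of_notMem _ h h0, map_zero, sub_self, sub_self]
  have hincl : incl Γ S = ∑ X ∈ Γ.powerset with (0 : Site d) ∈ X, incl X (Φ.toFun X) := by
    rw [Finset.sum_filter, ← Finset.sum_coe_sort, map_sum]
    refine Finset.sum_congr rfl fun X _ => ?_
    split_ifs
    · rw [incl_embed]
    · rw [map_zero]
  have htail : ‖W - incl Γ S‖ ≤ Φ.tail Γ := by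
    rw [hincl]
    exact tsum_sub_sum_le (g := fun X => incl X (Φ.toFun X)) (b := fun X => ‖Φ.toFun X‖)
      (fun X => (norm_incl _ _).le) hΦ Γ
  rw [hdiff]
  refine (norm_sub_siteAvg_le h0 h0Y hS B).trans ?_
  have h1 : ‖incl Γ S - incl Y B‖ ≤ ‖W - incl Γ S‖ + ‖W - A.1‖ + ‖A.1 - incl Y B‖ := by
    have : incl Γ S - incl Y B = -(W - incl Γ S) + (W - A.1) + (A.1 - incl Y B) := by abel
    rw [this]
    refine (norm_add₃_le).trans ?_
    rw [norm_neg]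
  rw [dist_eq_norm] at hAC
  linarith

theorem norm_hamiltonian_sub_siteAvg_le (ht : Φ.TranslationInvariant)
    (hΦ : Summable fun X : {X : Finset (Site d) // (0 : Site d) ∈ X} => ‖Φ.toFun X.1‖)
    {Λ : Finset (Site d)} (x : Λ) :
    ‖Φ.hamiltonian Λ - siteAvg x (Φ.hamiltonian Λ)‖ ≤
      Φ.lipschitz + 2 * Φ.tail (shift (-x.1) Λ) := by
  obtain ⟨x, hx⟩ := x
  obtain ⟨Γ, rfl⟩ : ∃ Γ, Λ = shift x Γ :=
    ⟨shift (-x) Λ, by rw [shift_shift, neg_add_cancel, shift_zero]⟩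
  have h0 : (0 : Site d) ∈ Γ := by simpa [mem_shift] using hx
  have e : (⟨x, hx⟩ : shift x Γ) = ⟨(⟨0, h0⟩ : Γ).1 + x, add_mem_shift x h0⟩ := by
    simp
  simp only [shift_shift, add_neg_cancel, shift_zero]
  rw [e, hamiltonian_shift ht, translateHom_apply, siteAvg_translate, ← translateHom_apply,
    ← translateHom_apply, ← map_sub, norm_translateHom]
  exact norm_hamiltonian_sub_siteAvg_zero_le hΦ h0

end Interaction

end Lattice

/-! ### Boxes -/

section Boxes

variable {d : ℕ}

theorem tendsto_eval_atTop (i : Fin d) :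
    Tendsto (fun a : Fin d → ℕ+ => a i) atTop atTop :=
  tendsto_atTop.2 fun b => (eventually_ge_atTop fun _ => b).mono fun _ h => h i

theorem tendsto_pnat_coe_atTop : Tendsto (fun n : ℕ+ => ((n : ℕ) : ℝ)) atTop atTop := by
  refine tendsto_natCast_atTop_atTop.comp (tendsto_atTop.2 fun b => ?_)
  filter_upwards [eventually_ge_atTop b.succPNat] with n hn
  have : ((b.succPNat : ℕ+) : ℕ) ≤ n := hn
  rw [Nat.succPNat_coe] at this
  omega

theorem card_box (a : Fin d → ℕ+) : (box a).card = ∏ i, 2 * (a i : ℕ) := by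
  rw [box, Fintype.card_piFinset]
  refine Finset.prod_congr rfl fun i _ => ?_
  rw [Int.card_Ico]
  omega

theorem card_box_pos (a : Fin d → ℕ+) : 0 < (box a).card := by
  rw [card_box]
  exact Finset.prod_pos fun i _ => Nat.mul_pos two_pos (a i).pos

theorem tendsto_inv_card_box [NeZero d] :
    Tendsto (fun a : Fin d → ℕ+ => ((box a).card : ℝ)⁻¹) atTop (𝓝 0) := by
  refine tendsto_inv_atTop_zero.comp (tendsto_atTop_mono (fun a => ?_)
    (tendsto_pnat_coe_atTop.comp (tendsto_eval_atTop (0 : Fin d))))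
  have h1 : 2 * (a 0 : ℕ) ∣ (box a).card := by
    rw [card_box]
    exact Finset.dvd_prod_of_mem (fun i => 2 * (a i : ℕ)) (Finset.mem_univ 0)
  have h2 := Nat.le_of_dvd (card_box_pos a) h1
  simp only [Function.comp]
  exact_mod_cast (by omega : (a 0 : ℕ) ≤ (box a).card)

theorem tendsto_interval_overlap (z : ℤ) :
    Tendsto (fun n : ℕ+ => (({x ∈ Finset.Ico (-((n : ℕ) : ℤ)) ((n : ℕ) : ℤ) |
      x + z ∈ Finset.Ico (-((n : ℕ) : ℤ)) ((n : ℕ) : ℤ)}.card : ℝ)) / ((2 * (n : ℕ) : ℕ) : ℝ))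
      atTop (𝓝 1) := by
  have hlow : Tendsto (fun n : ℕ+ => 1 - (z.natAbs : ℝ) / 2 * ((n : ℕ) : ℝ)⁻¹) atTop (𝓝 1) := by
    simpa using (tendsto_inv_atTop_zero.comp tendsto_pnat_coe_atTop).const_mul
      ((z.natAbs : ℝ) / 2) |>.const_sub 1
  refine tendsto_of_tendsto_of_tendsto_of_le_of_le hlow tendsto_const_nhds (fun n => ?_) fun n => ?_
  · have hn : (0 : ℝ) < ((n : ℕ) : ℝ) := by exact_mod_cast n.pos
    have hc : (2 * (n : ℕ) : ℤ) - z.natAbs ≤ ({x ∈ Finset.Ico (-((n : ℕ) : ℤ)) ((n : ℕ) : ℤ) |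
      x + z ∈ Finset.Ico (-((n : ℕ) : ℤ)) ((n : ℕ) : ℤ)}.card : ℤ) := by
      have e : {x ∈ Finset.Ico (-((n : ℕ) : ℤ)) ((n : ℕ) : ℤ) |
          x + z ∈ Finset.Ico (-((n : ℕ) : ℤ)) ((n : ℕ) : ℤ)} =
          Finset.Ico (max (-((n : ℕ) : ℤ)) (-((n : ℕ) : ℤ) - z)) (min (n : ℕ) ((n : ℕ) - z)) := by
        ext x
        simp only [Finset.mem_filter, Finset.mem_Ico]
        omega
      rw [e, Int.card_Ico]
      omega
    have hc' : 2 * ((n : ℕ) : ℝ) - z.natAbs ≤ ({x ∈ Finset.Ico (-((n : ℕ) : ℤ)) ((n : ℕ) : ℤ) |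
      x + z ∈ Finset.Ico (-((n : ℕ) : ℤ)) ((n : ℕ) : ℤ)}.card : ℝ) := by exact_mod_cast hc
    rw [le_div_iff₀ (by positivity)]
    refine le_trans (le_of_eq ?_) hc'
    push_cast
    field_simp
  · refine div_le_one_of_le₀ ?_ (by positivity)
    have := Finset.card_filter_le (Finset.Ico (-((n : ℕ) : ℤ)) ((n : ℕ) : ℤ))
      (fun x => x + z ∈ Finset.Ico (-((n : ℕ) : ℤ)) ((n : ℕ) : ℤ))
    rw [Int.card_Ico] at this
    rw [Nat.cast_le]
    omega

/-- The proportion of sites that stay in the box under the shift is a product of one-dimensional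
overlap ratios, each tending to 1. -/
theorem tendsto_box_boundary (y : Site d) :
    Tendsto (fun a : Fin d → ℕ+ => (({x ∈ box a | x + y ∉ box a}.card : ℝ)) / ((box a).card : ℝ))
      atTop (𝓝 0) := by
  have h1 : Tendsto (fun a : Fin d → ℕ+ => ∏ i, (({x ∈ Finset.Ico (-((a i : ℕ) : ℤ)) ((a i : ℕ) : ℤ) |
      x + y i ∈ Finset.Ico (-((a i : ℕ) : ℤ)) ((a i : ℕ) : ℤ)}.card : ℝ)) / ((2 * (a i : ℕ) : ℕ) : ℝ))
      atTop (𝓝 (∏ _i : Fin d, (1 : ℝ))) :=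
    tendsto_finsetProd _ fun i _ => (tendsto_interval_overlap (y i)).comp (tendsto_eval_atTop i)
  rw [Finset.prod_const_one] at h1
  have h2 := h1.const_sub 1
  rw [sub_self] at h2
  refine h2.congr fun a => ?_
  have hpos : (0 : ℝ) < (box a).card := by exact_mod_cast card_box_pos a
  have e1 : {x ∈ box a | x + y ∈ box a} = Fintype.piFinset fun i =>
      {x ∈ Finset.Ico (-((a i : ℕ) : ℤ)) ((a i : ℕ) : ℤ) |
        x + y i ∈ Finset.Ico (-((a i : ℕ) : ℤ)) ((a i : ℕ) : ℤ)} := by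
    ext x
    simp only [box, Finset.mem_filter, Fintype.mem_piFinset, Pi.add_apply, forall_and]
  have e2 := congrArg Finset.card e1
  rw [Fintype.card_piFinset] at e2
  have e3 := Finset.card_filter_add_card_filter_not (s := box a) (fun x => x + y ∈ box a)
  rw [Finset.prod_div_distrib, ← Nat.cast_prod, ← Nat.cast_prod, ← e2, ← card_box, eq_div_iff hpos.ne',
    sub_mul, div_mul_cancel₀ _ hpos.ne', ← e3]
  push_cast
  ring

end Boxes

/-! ### Subadditive functions of boxes -/

section Subadditive

variable {d : ℕ} {g : Finset (Site d) → ℝ}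

/-- Carrying the extra set U makes the empty family an equality, so no sign condition on g ∅ is
needed. -/
theorem le_sum_of_subadditive (hg : ∀ S T, Disjoint S T → g (S ∪ T) ≤ g S + g T) {ι : Type*}
    [DecidableEq ι] (A : Finset ι) {t : ι → Finset (Site d)} {U : Finset (Site d)}
    (ht : ∀ i ∈ A, ∀ j ∈ A, i ≠ j → Disjoint (t i) (t j)) (hU : ∀ i ∈ A, Disjoint (t i) U) :
    g (A.biUnion t ∪ U) ≤ ∑ i ∈ A, g (t i) + g U := by
  induction A using Finset.induction_on with
  | empty => simp
  | insert i A hi ih =>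
    rw [Finset.biUnion_insert, Finset.union_assoc, Finset.sum_insert hi, add_assoc]
    refine (hg _ _ ?_).trans (add_le_add_right (ih (fun j hj k hk => ht j (Finset.mem_insert_of_mem hj)
      k (Finset.mem_insert_of_mem hk)) fun j hj => hU j (Finset.mem_insert_of_mem hj)) _)
    rw [Finset.disjoint_union_right, Finset.disjoint_biUnion_right]
    exact ⟨fun j hj => ht i (Finset.mem_insert_self _ _) j (Finset.mem_insert_of_mem hj)
      fun e => hi (e ▸ hj), hU i (Finset.mem_insert_self _ _)⟩

/-- The tiles of the tiling of the lattice by translates of the box `box b`. -/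
noncomputable def tile (b : Fin d → ℕ+) (y : Site d) : Finset (Site d) :=
  shift (fun i => 2 * (b i : ℕ) * y i) (box b)

/-- The index of the tile of a site. -/
def tileIndex (b : Fin d → ℕ+) (x : Site d) : Site d := fun i => (x i + (b i : ℕ)) / (2 * (b i : ℕ))

theorem mem_tile {b : Fin d → ℕ+} {x y : Site d} : x ∈ tile b y ↔ tileIndex b x = y := by
  rw [tile, mem_shift, box, Fintype.mem_piFinset, funext_iff]
  refine forall_congr' fun i => ?_
  have hb : (0 : ℤ) < 2 * (b i : ℕ) := by have := (b i).pos; omega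
  rw [tileIndex, Int.ediv_eq_iff_of_pos hb, Finset.mem_Ico, Pi.sub_apply]
  constructor
  · rintro ⟨h1, h2⟩
    constructor <;> linarith
  · rintro ⟨h1, h2⟩
    constructor <;> linarith

/-- Fill the large box with the tiles that fit inside it (T) and split the remainder R into single
sites. Each tile costs g (box b), each remaining site costs g {0}, and R is a negligible fraction of
the box. -/
theorem eventually_subadditive_box_le [NeZero d]
    (hg : ∀ S T, Disjoint S T → g (S ∪ T) ≤ g S + g T) (hs : ∀ x S, g (shift x S) = g S)
    (b : Fin d → ℕ+) {ε : ℝ} (hε : 0 < ε) :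
    ∀ᶠ a : Fin d → ℕ+ in atTop, g (box a) / (box a).card ≤ g (box b) / (box b).card + ε := by
  classical
  set C := g {0} with hC
  set Z : Finset (Site d) := Finset.image₂ (fun p p' => p - p') (box b) (box b) with hZ
  let T : (Fin d → ℕ+) → Finset (Site d) := fun a =>
    {y ∈ (box a).image (tileIndex b) | tile b y ⊆ box a}
  let R : (Fin d → ℕ+) → Finset (Site d) := fun a => box a \ (T a).biUnion (tile b)
  have hR : Tendsto (fun a => ((R a).card : ℝ) / (box a).card) atTop (𝓝 0) := by
    have h := tendsto_finsetSum Z fun z (_ : z ∈ Z) => tendsto_box_boundary z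
    rw [Finset.sum_const_zero] at h
    refine squeeze_zero (fun a => by positivity) (fun a => ?_) h
    rw [← Finset.sum_div]
    gcongr
    -- The tile of a remaining site x has a point w outside the box, and w - x lies in the fixed
    -- finite difference set Z.
    have hsub : R a ⊆ Z.biUnion fun z => {x ∈ box a | x + z ∉ box a} := by
      intro x hx
      obtain ⟨hx1, hx2⟩ := Finset.mem_sdiff.1 hx
      have hnot : ¬ tile b (tileIndex b x) ⊆ box a := fun h => hx2 (Finset.mem_biUnion.2
        ⟨tileIndex b x, Finset.mem_filter.2 ⟨Finset.mem_image_of_mem _ hx1, h⟩, mem_tile.2 rfl⟩)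
      obtain ⟨w, hw1, hw2⟩ := Finset.not_subset.1 hnot
      have hx3 : x ∈ tile b (tileIndex b x) := mem_tile.2 rfl
      rw [tile, mem_shift] at hw1 hx3
      refine Finset.mem_biUnion.2 ⟨w - x, Finset.mem_image₂.2 ⟨_, hw1, _, hx3, by simp⟩,
        Finset.mem_filter.2 ⟨hx1, by simpa using hw2⟩⟩
    exact_mod_cast (Finset.card_le_card hsub).trans Finset.card_biUnion_le
  have hbpos : (0 : ℝ) < (box b).card := by exact_mod_cast card_box_pos b
  set u := g (box b) / (box b).card with hu
  have hdisj : ∀ y y', y ≠ y' → Disjoint (tile b y) (tile b y') := fun y y' h =>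
    Finset.disjoint_left.2 fun x h1 h2 => h ((mem_tile.1 h1).symm.trans (mem_tile.1 h2))
  have hbound : ∀ a, g (box a) / (box a).card ≤
      g ∅ * ((box a).card : ℝ)⁻¹ + (1 - (R a).card / (box a).card) * u +
        C * ((R a).card / (box a).card) := by
    intro a
    have hpos : (0 : ℝ) < (box a).card := by exact_mod_cast card_box_pos a
    have hsubU : (T a).biUnion (tile b) ⊆ box a :=
      Finset.biUnion_subset.2 fun y hy => (Finset.mem_filter.1 hy).2
    have h1 : g ((T a).biUnion (tile b)) ≤ (T a).card * g (box b) + g ∅ := by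
      have := le_sum_of_subadditive hg (T a) (t := tile b) (U := ∅)
        (fun y _ y' _ h => hdisj y y' h) (fun _ _ => Finset.disjoint_empty_right _)
      simpa [tile, hs] using this
    have h2 : g (box a) ≤ (R a).card * C + g ((T a).biUnion (tile b)) := by
      have := le_sum_of_subadditive hg (R a) (t := fun x => {x}) (U := (T a).biUnion (tile b))
        (fun x _ y _ h => by simpa using h)
        (fun x hx => by simpa using (Finset.mem_sdiff.1 hx).2)
      rw [Finset.biUnion_singleton_eq_self, Finset.sdiff_union_of_subset hsubU] at this
      have hsing : ∀ x : Site d, g {x} = C := by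
        intro x
        rw [hC, ← hs x {0}]
        congr 1
        ext z
        simp [mem_shift, sub_eq_zero]
      simp only [hsing, Finset.sum_const, nsmul_eq_mul] at this
      exact this
    have h3 : ((R a).card : ℝ) + (T a).card * (box b).card = (box a).card := by
      have e1 := Finset.card_sdiff_add_card_eq_card hsubU
      rw [Finset.card_biUnion fun y _ y' _ h => hdisj y y' h] at e1
      simp only [tile, card_shift, Finset.sum_const, smul_eq_mul] at e1
      exact_mod_cast e1
    have h4 : g (box b) = u * (box b).card := by rw [hu, div_mul_cancel₀ _ hbpos.ne']
    rw [div_le_iff₀ hpos]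
    have e5 : ∀ G B r v c : ℝ, 0 < B →
        (G * B⁻¹ + (1 - r / B) * v + c * (r / B)) * B = G + (B - r) * v + c * r := by
      intro G B r v c hB
      field_simp
    rw [e5 _ _ _ _ _ hpos, ← h3]
    rw [h4] at h1
    linarith
  have hlim : Tendsto (fun a => g ∅ * ((box a).card : ℝ)⁻¹ + (1 - (R a).card / (box a).card) * u +
        C * ((R a).card / (box a).card)) atTop (𝓝 (g ∅ * 0 + (1 - 0) * u + C * 0)) :=
    ((tendsto_inv_card_box.const_mul _).add ((hR.const_sub 1).mul_const u)).add (hR.const_mul C)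
  simp only [mul_zero, sub_zero, one_mul, zero_add, add_zero] at hlim
  filter_upwards [hlim.eventually (gt_mem_nhds (lt_add_of_pos_right u hε))] with a ha
  exact (hbound a).trans ha.le

/-- Fekete's lemma for boxes. -/
theorem exists_tendsto_of_subadditive [NeZero d]
    (hg : ∀ S T, Disjoint S T → g (S ∪ T) ≤ g S + g T) (hs : ∀ x S, g (shift x S) = g S)
    {C : ℝ} (hC : ∀ a : Fin d → ℕ+, C ≤ g (box a) / (box a).card) :
    ∃ l, Tendsto (fun a : Fin d → ℕ+ => g (box a) / (box a).card) atTop (𝓝 l) := by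
  have hbdd : BddBelow (Set.range fun a : Fin d → ℕ+ => g (box a) / ((box a).card : ℝ)) :=
    ⟨C, by rintro _ ⟨a, rfl⟩; exact hC a⟩
  refine ⟨⨅ a : Fin d → ℕ+, g (box a) / ((box a).card : ℝ), tendsto_order.2 ⟨fun r hr => ?_, fun r hr => ?_⟩⟩
  · exact Eventually.of_forall fun a => hr.trans_le (ciInf_le hbdd a)
  · obtain ⟨b, hb⟩ := exists_lt_of_ciInf_lt hr
    filter_upwards [eventually_subadditive_box_le hg hs b (half_pos (sub_pos.2 hb))] with a ha
    linarith

end Subadditive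

/-! ### Sums over the subsets of a region -/

section PowersetSums

variable {d : ℕ}

/-- The empty set is the only common subset of disjoint S and T, hence the correction f ∅. -/
theorem sum_powerset_union {E : Type*} [AddCommGroup E] (f : Finset (Site d) → E)
    {S T : Finset (Site d)} (h : Disjoint S T) :
    ∑ X ∈ (S ∪ T).powerset, f X = ∑ X ∈ (S ∪ T).powerset \ (S.powerset ∪ T.powerset), f X +
      (∑ X ∈ S.powerset, f X + ∑ X ∈ T.powerset, f X - f ∅) := by
  have hsub : S.powerset ∪ T.powerset ⊆ (S ∪ T).powerset :=
    Finset.union_subset (Finset.powerset_mono.2 Finset.subset_union_left)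
      (Finset.powerset_mono.2 Finset.subset_union_right)
  have hinter : S.powerset ∩ T.powerset = {∅} := by
    ext X
    rw [Finset.mem_inter, Finset.mem_powerset, Finset.mem_powerset, ← Finset.subset_inter_iff,
      Finset.disjoint_iff_inter_eq_empty.1 h, Finset.subset_empty, Finset.mem_singleton]
  rw [← Finset.sum_sdiff hsub, ← Finset.sum_union_inter (s₁ := S.powerset), hinter,
    Finset.sum_singleton, add_sub_cancel_right]

theorem sum_powerset_shift {E : Type*} [AddCommMonoid E] {f : Finset (Site d) → E}
    (hf : ∀ x X, f (shift x X) = f X) (x : Site d) (Λ : Finset (Site d)) :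
    ∑ X ∈ (shift x Λ).powerset, f X = ∑ X ∈ Λ.powerset, f X := by
  symm
  refine Finset.sum_bij' (fun X _ => shift x X) (fun X _ => shift (-x) X) (fun X hX => ?_)
    (fun X hX => ?_) (fun X _ => ?_) (fun X _ => ?_) (fun X _ => (hf x X).symm)
  · exact Finset.mem_powerset.2 (shift_subset_iff.2 (Finset.mem_powerset.1 hX))
  · rw [Finset.mem_powerset, ← shift_subset_iff (x := x), shift_shift, neg_add_cancel, shift_zero]
    exact Finset.mem_powerset.1 hX
  · rw [shift_shift, add_neg_cancel, shift_zero]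
  · rw [shift_shift, neg_add_cancel, shift_zero]

/-- A translation-invariant sum over the subsets of `Λ`, distributed over the sites of `Λ`. -/
theorem sum_powerset_eq_sum_sites {K : Type*} [Field K] [CharZero K] {f : Finset (Site d) → K}
    (hf : ∀ x X, f (shift x X) = f X) (Λ : Finset (Site d)) :
    ∑ X ∈ Λ.powerset, f X = f ∅ + ∑ x ∈ Λ,
      ∑ X ∈ (shift (-x) Λ).powerset with (0 : Site d) ∈ X, (X.card : K)⁻¹ * f X := by
  have h1 : ∀ x ∈ Λ, ∑ X ∈ (shift (-x) Λ).powerset with (0 : Site d) ∈ X, (X.card : K)⁻¹ * f X =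
      ∑ X ∈ Λ.powerset, if x ∈ X then (X.card : K)⁻¹ * f X else 0 := by
    intro x _
    rw [Finset.sum_filter]
    refine Finset.sum_bij' (fun X _ => shift x X) (fun X _ => shift (-x) X) (fun X hX => ?_)
      (fun X hX => ?_) (fun X _ => ?_) (fun X _ => ?_) (fun X _ => ?_)
    · rw [Finset.mem_powerset, ← shift_subset_iff (x := -x), shift_shift, add_neg_cancel, shift_zero]
      exact Finset.mem_powerset.1 hX
    · exact Finset.mem_powerset.2 (shift_subset_iff.2 (Finset.mem_powerset.1 hX))
    · rw [shift_shift, add_neg_cancel, shift_zero]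
    · rw [shift_shift, neg_add_cancel, shift_zero]
    · rw [card_shift, hf]
      exact if_congr (by simp [mem_shift]) rfl rfl
  -- Double counting: a nonempty X receives weight 1/|X| from each of its |X| sites, while the empty
  -- set belongs to no site and is split off.
  rw [Finset.sum_congr rfl h1, Finset.sum_comm, ← Finset.sum_erase_add _ _
    (Finset.empty_mem_powerset Λ), ← Finset.sum_erase_add _ _ (Finset.empty_mem_powerset Λ)]
  simp only [Finset.notMem_empty, if_false, Finset.sum_const_zero, add_zero]
  rw [add_comm]
  congr 1
  refine Finset.sum_congr rfl fun X hX => ?_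
  obtain ⟨hX1, hX2⟩ := Finset.mem_erase.1 hX
  have hc : (X.card : K) ≠ 0 := Nat.cast_ne_zero.2 (Finset.card_ne_zero.2
    (Finset.nonempty_iff_ne_empty.2 hX1))
  rw [← Finset.sum_filter, Finset.filter_mem_eq_inter,
    Finset.inter_eq_right.2 (Finset.mem_powerset.1 hX2), Finset.sum_const, nsmul_eq_mul,
    mul_inv_cancel_left₀ hc]

end PowersetSums

/-! ### The thermodynamic limit -/

section Thermodynamic

variable {d q : ℕ}

theorem trace_embed_mul_embed {S T : Finset (Site d)} (h : Disjoint S T) (A : Alg q S)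
    (B : Alg q T) :
    (embed q (Finset.subset_union_left : S ≤ S ∪ T) A *
      embed q (Finset.subset_union_right : T ≤ S ∪ T) B).trace = A.trace * B.trace := by
  have hdiag : ∀ s : Config q (S ∪ T), (embed q (Finset.subset_union_left : S ≤ S ∪ T) A *
      embed q (Finset.subset_union_right : T ≤ S ∪ T) B) s s =
      A (fun x => s ⟨x.1, Finset.subset_union_left x.2⟩) (fun x => s ⟨x.1, Finset.subset_union_left x.2⟩) *
      B (fun x => s ⟨x.1, Finset.subset_union_right x.2⟩)
        (fun x => s ⟨x.1, Finset.subset_union_right x.2⟩) := by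
    intro s
    rw [Matrix.mul_apply, Finset.sum_eq_single s]
    · simp [embed_apply]
    · intro t _ hts
      rw [embed_apply, embed_apply]
      by_cases h1 : ∀ x : (S ∪ T : Finset _), x.1 ∉ S → s x = t x
      -- A nonzero product would force s and t to agree off S and off T, hence everywhere because S
      -- and T are disjoint.
      · rw [if_neg (c := ∀ x : (S ∪ T : Finset _), x.1 ∉ T → t x = s x), mul_zero, mul_zero]
        intro h2
        refine hts (funext fun x => ?_)
        by_cases hx : x.1 ∈ S
        · exact h2 x (Finset.disjoint_left.1 h hx)
        · exact (h1 x hx).symm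
      · rw [if_neg h1, mul_zero, zero_mul]
    · simp
  let e : Config q (S ∪ T) ≃ Config q S × Config q T :=
    { toFun := fun s => (fun x => s ⟨x.1, Finset.subset_union_left x.2⟩,
        fun x => s ⟨x.1, Finset.subset_union_right x.2⟩)
      invFun := fun p x => if hx : x.1 ∈ S then p.1 ⟨x.1, hx⟩ else
        p.2 ⟨x.1, (Finset.mem_union.1 x.2).resolve_left hx⟩
      left_inv := fun s => by
        funext x
        by_cases hx : x.1 ∈ S <;> simp [hx]
      right_inv := fun p => by
        refine Prod.ext (funext fun x => ?_) (funext fun x => ?_)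
        · simp
        · have : x.1 ∉ S := Finset.disjoint_right.1 h x.2
          simp [this] }
  refine (Finset.sum_congr rfl fun s _ => hdiag s).trans ?_
  rw [Matrix.trace, Matrix.trace, Finset.sum_mul_sum, ← Finset.sum_product']
  exact e.sum_comp fun p => A p.1 p.1 * B p.2 p.2

/-- The rational scalar multiplication of matrices is compatible with the operator norm. -/
theorem norm_rat_smul_matrix_le {n : Type*} [Fintype n] [DecidableEq n] (r : ℚ)
    (A : Matrix n n ℂ) : ‖r • A‖ ≤ ‖r‖ * ‖A‖ := by
  have h : r • A = (r : ℂ) • A := by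
    ext i j
    simp [Rat.smul_def]
  rw [h, norm_smul]
  exact mul_le_mul_of_nonneg_right (norm_algebraMap' ℂ r).le (norm_nonneg _)

/-- Matrices with the operator norm form a normed algebra over the rationals. -/
noncomputable abbrev matrixNormedAlgebraRat (n : Type*) [Fintype n] [DecidableEq n] :
    NormedAlgebra ℚ (Matrix n n ℂ) :=
  { (inferInstance : Algebra ℚ (Matrix n n ℂ)) with norm_smul_le := norm_rat_smul_matrix_le }

theorem exp_embed [NeZero q] {Λ Λ' : Finset (Site d)} (h : Λ ≤ Λ') (A : Alg q Λ) :
    NormedSpace.exp (embed q h A) = embed q h (NormedSpace.exp A) := by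
  have hc : Continuous (embed q h) :=
    (AddMonoidHomClass.isometry_of_norm (embed q h) (norm_embed h)).continuous
  let := matrixNormedAlgebraRat (Config q Λ)
  exact (NormedSpace.map_exp (embed q h) hc A).symm

theorem exp_translateHom (x : Site d) {Λ : Finset (Site d)} (A : Alg q Λ) :
    NormedSpace.exp (translateHom q x Λ A) = translateHom q x Λ (NormedSpace.exp A) := by
  have hc : Continuous (translateHom q x Λ) :=
    (AddMonoidHomClass.isometry_of_norm (translateHom q x Λ) (norm_translateHom x Λ)).continuous
  let := matrixNormedAlgebraRat (Config q Λ)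
  exact (NormedSpace.map_exp (translateHom q x Λ) hc A).symm

namespace Interaction

/-- The logarithm of the partition function. -/
noncomputable def logPartition (Φ : Interaction d q) (Λ : Finset (Site d)) : ℝ :=
  Real.log (NormedSpace.exp (-(Φ.hamiltonian Λ))).trace.re

/-- The total strength of the interaction terms inside `Λ`. -/
noncomputable def strength (Φ : Interaction d q) (Λ : Finset (Site d)) : ℝ :=
  ∑ X ∈ Λ.powerset, ‖Φ.toFun X‖

variable {Φ : Interaction d q}

theorem logPartition_shift (ht : Φ.TranslationInvariant) (x : Site d) (Λ : Finset (Site d)) :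
    Φ.logPartition (shift x Λ) = Φ.logPartition Λ := by
  rw [logPartition, hamiltonian_shift ht, ← map_neg, exp_translateHom, trace_translateHom,
    logPartition]

theorem norm_toFun_shift (ht : Φ.TranslationInvariant) (x : Site d) (Λ : Finset (Site d)) :
    ‖Φ.toFun (shift x Λ)‖ = ‖Φ.toFun Λ‖ := by
  rw [ht, ← translateHom_apply, norm_translateHom]

theorem strength_shift (ht : Φ.TranslationInvariant) (x : Site d) (Λ : Finset (Site d)) :
    Φ.strength (shift x Λ) = Φ.strength Λ :=
  sum_powerset_shift (norm_toFun_shift ht) x Λ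

theorem strength_union {S T : Finset (Site d)} (h : Disjoint S T) :
    Φ.strength (S ∪ T) = ∑ X ∈ (S ∪ T).powerset \ (S.powerset ∪ T.powerset), ‖Φ.toFun X‖ +
      (Φ.strength S + Φ.strength T - ‖Φ.toFun ∅‖) :=
  sum_powerset_union _ h

theorem strength_le (ht : Φ.TranslationInvariant)
    (hΦ : Summable fun X : {X : Finset (Site d) // (0 : Site d) ∈ X} => ‖Φ.toFun X.1‖)
    (Λ : Finset (Site d)) :
    Φ.strength Λ ≤ ‖Φ.toFun ∅‖ +
      Λ.card * ∑' X : {X : Finset (Site d) // (0 : Site d) ∈ X}, ‖Φ.toFun X.1‖ := by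
  rw [strength, sum_powerset_eq_sum_sites (norm_toFun_shift ht)]
  gcongr
  rw [← nsmul_eq_mul, ← Finset.sum_const]
  refine Finset.sum_le_sum fun x _ => ?_
  rw [← Finset.sum_subtype_eq_sum_filter]
  refine le_trans (Finset.sum_le_sum fun X _ => ?_) (hΦ.sum_le_tsum _ fun _ _ => norm_nonneg _)
  exact mul_le_of_le_one_left (norm_nonneg _) (Nat.cast_inv_le_one _)

variable [NeZero q]

theorem incl_hamiltonian (Φ : Interaction d q) (Λ : Finset (Site d)) :
    incl Λ (Φ.hamiltonian Λ) = ∑ X ∈ Λ.powerset, incl X (Φ.toFun X) := by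
  rw [hamiltonian, map_sum]
  simp only [incl_embed]
  exact Finset.sum_coe_sort Λ.powerset fun X => incl X (Φ.toFun X)

theorem norm_hamiltonian_le (Φ : Interaction d q) (Λ : Finset (Site d)) :
    ‖Φ.hamiltonian Λ‖ ≤ Φ.strength Λ := by
  rw [← norm_incl, incl_hamiltonian]
  exact (norm_sum_le _ _).trans (le_of_eq (Finset.sum_congr rfl fun X _ => norm_incl _ _))

/-- Replace H_{S∪T} by H_S + H_T at the cost of the norm of the difference, then factorize the
trace. One ‖Φ(∅)‖ appears because Φ(∅) occurs in both H_S and H_T, the other because the difference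
of strengths also subtracts it once. -/
theorem logPartition_union_le {S T : Finset (Site d)} (h : Disjoint S T) :
    Φ.logPartition (S ∪ T) ≤ Φ.logPartition S + Φ.logPartition T +
      (Φ.strength (S ∪ T) - Φ.strength S - Φ.strength T + 2 * ‖Φ.toFun ∅‖) := by
  have hl : S ≤ S ∪ T := Finset.subset_union_left
  have hr : T ≤ S ∪ T := Finset.subset_union_right
  have hS := (isSelfAdjoint_hamiltonian Φ S).neg
  have hT := (isSelfAdjoint_hamiltonian Φ T).neg
  have hS' := hS.map (embed q hl)
  have hT' := hT.map (embed q hr)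
  have h1 := log_trace_exp_le_add_norm (isSelfAdjoint_hamiltonian Φ (S ∪ T)).neg (hS'.add hT')
  have h2 := trace_exp_add_le hS' hT'
  have him : ((NormedSpace.exp (-(Φ.hamiltonian S))).trace).im = 0 :=
    (Complex.le_def.1 (Matrix.nonneg_iff_posSemidef.1 hS.exp_nonneg).trace_nonneg).2.symm
  rw [exp_embed, exp_embed, trace_embed_mul_embed h, Complex.mul_re, him, zero_mul, sub_zero] at h2
  have h3 := Real.log_le_log (trace_exp_pos (hS'.add hT')) h2
  rw [Real.log_mul (trace_exp_pos hS).ne' (trace_exp_pos hT).ne'] at h3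
  have h4 : ‖-(Φ.hamiltonian (S ∪ T)) - (embed q hl (-(Φ.hamiltonian S)) +
      embed q hr (-(Φ.hamiltonian T)))‖ ≤
      Φ.strength (S ∪ T) - Φ.strength S - Φ.strength T + 2 * ‖Φ.toFun ∅‖ := by
    rw [← norm_incl, map_sub, map_add, incl_embed, incl_embed, map_neg, map_neg, map_neg,
      incl_hamiltonian, incl_hamiltonian, incl_hamiltonian, sum_powerset_union _ h, strength_union h]
    set V := ∑ X ∈ (S ∪ T).powerset \ (S.powerset ∪ T.powerset), incl X (Φ.toFun X) with hV
    have e : ∀ a b c v : QuasiLocal d q, -(v + (a + b - c)) - (-a + -b) = -v + c := by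
      intros; abel
    rw [e]
    have h5 : ‖V‖ ≤ ∑ X ∈ (S ∪ T).powerset \ (S.powerset ∪ T.powerset), ‖Φ.toFun X‖ :=
      (norm_sum_le _ _).trans (le_of_eq (Finset.sum_congr rfl fun X _ => norm_incl _ _))
    have h6 := norm_add_le (-V) (incl ∅ (Φ.toFun ∅))
    rw [norm_neg, norm_incl] at h6
    linarith
  simp only [logPartition]
  linarith

theorem exists_tendsto_boxPressure [NeZero d] (ht : Φ.TranslationInvariant)
    (hΦ : Summable fun X : {X : Finset (Site d) // (0 : Site d) ∈ X} => ‖Φ.toFun X.1‖) :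
    ∃ l, Tendsto Φ.boxPressure atTop (𝓝 l) := by
  set M := ∑' X : {X : Finset (Site d) // (0 : Site d) ∈ X}, ‖Φ.toFun X.1‖ with hM
  set n₀ := ‖Φ.toFun ∅‖ with hn₀
  have hn₀' : 0 ≤ n₀ := norm_nonneg _
  have hcard : ∀ a : Fin d → ℕ+, (1 : ℝ) ≤ (box a).card := fun a => by
    exact_mod_cast card_box_pos a
  -- Subtracting the strength absorbs the terms joining two regions; the constant 2n₀ absorbs the
  -- excess from the empty set.
  obtain ⟨l₁, h₁⟩ := exists_tendsto_of_subadditive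
    (g := fun S => Φ.logPartition S - Φ.strength S + 2 * n₀) (C := -(2 * M + 2 * n₀))
    (fun S T h => by have := Φ.logPartition_union_le h; linarith)
    (fun x S => by rw [logPartition_shift ht, strength_shift ht]) (fun a => by
      have h1 := norm_hamiltonian_le Φ (box a)
      have h2 := strength_le ht hΦ (box a)
      have h3 := log_trace_exp_le_add_norm (IsSelfAdjoint.zero (Alg q (box a)))
        (isSelfAdjoint_hamiltonian Φ (box a)).neg
      rw [NormedSpace.exp_zero, Matrix.trace_one, Complex.natCast_re, zero_sub, neg_neg] at h3
      have h4 : 0 ≤ Real.log (Fintype.card (Config q (box a))) := Real.log_natCast_nonneg _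
      have h5 := hcard a
      rw [le_div_iff₀ (by linarith)]
      simp only [logPartition]
      nlinarith)
  obtain ⟨l₂, h₂⟩ := exists_tendsto_of_subadditive
    (g := fun S => -Φ.strength S + n₀) (C := -(M + n₀))
    (fun S T h => by
      have h1 := Φ.strength_union h
      have h2 : 0 ≤ ∑ X ∈ (S ∪ T).powerset \ (S.powerset ∪ T.powerset), ‖Φ.toFun X‖ :=
        Finset.sum_nonneg fun _ _ => norm_nonneg _
      linarith)
    (fun x S => by rw [strength_shift ht]) (fun a => by
      have h2 := strength_le ht hΦ (box a)
      have h5 := hcard a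
      rw [le_div_iff₀ (by linarith)]
      nlinarith)
  -- The two subadditive functions differ by the log-partition function plus n₀, and n₀ divided by
  -- the volume vanishes.
  refine ⟨l₁ - l₂ - n₀ * 0, ((h₁.sub h₂).sub (tendsto_inv_card_box.const_mul n₀)).congr fun a => ?_⟩
  have h5 : ((box a).card : ℝ) ≠ 0 := by have := hcard a; linarith
  rw [boxPressure, ← logPartition]
  field_simp
  ring

end Interaction

end Thermodynamic

/-! ### Vanishing of boundary effects and the bound on the pressure -/

section Bound

variable {d q : ℕ}

namespace Interaction

variable {Φ : Interaction d q}

theorem tail_nonneg (Φ : Interaction d q) (Γ : Finset (Site d)) : 0 ≤ Φ.tail Γ :=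
  tsum_nonneg fun X => by split_ifs <;> simp

theorem tail_le (hΦ : Summable fun X : {X : Finset (Site d) // (0 : Site d) ∈ X} => ‖Φ.toFun X.1‖)
    (Γ : Finset (Site d)) :
    Φ.tail Γ ≤ ∑' X : {X : Finset (Site d) // (0 : Site d) ∈ X}, ‖Φ.toFun X.1‖ := by
  have hle : ∀ X : {X : Finset (Site d) // (0 : Site d) ∈ X},
      (if X.1 ⊆ Γ then 0 else ‖Φ.toFun X.1‖) ≤ ‖Φ.toFun X.1‖ := fun X => by
    split_ifs
    · exact norm_nonneg _
    · exact le_rfl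
  exact Summable.tsum_le_tsum hle
    (Summable.of_nonneg_of_le (fun X => by split_ifs <;> simp) hle hΦ) hΦ

theorem ntr_toFun_shift (ht : Φ.TranslationInvariant) (x : Site d) (Λ : Finset (Site d)) :
    ntr (shift x Λ) (Φ.toFun (shift x Λ)) = ntr Λ (Φ.toFun Λ) := by
  rw [ntr_apply, ntr_apply, ht, ← translateHom_apply, trace_translateHom, card_shift]

/-- Exchanging the sums weights each ‖Φ(X)‖ by the proportion of box sites x for which X + x leaves
the box. For fixed X this tends to 0, and it never exceeds 1, so dominated convergence applies. -/
theorem tendsto_average_tail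
    (hΦ : Summable fun X : {X : Finset (Site d) // (0 : Site d) ∈ X} => ‖Φ.toFun X.1‖) :
    Tendsto (fun a : Fin d → ℕ+ => (∑ x ∈ box a, Φ.tail (shift (-x) (box a))) / ((box a).card : ℝ))
      atTop (𝓝 0) := by
  have hle : ∀ (Γ : Finset (Site d)) (X : {X : Finset (Site d) // (0 : Site d) ∈ X}),
      (if X.1 ⊆ Γ then 0 else ‖Φ.toFun X.1‖) ≤ ‖Φ.toFun X.1‖ := fun Γ X => by
    split_ifs
    · exact norm_nonneg _
    · exact le_rfl
  have hsum : ∀ Γ : Finset (Site d), Summable fun X : {X : Finset (Site d) // (0 : Site d) ∈ X} =>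
      (if X.1 ⊆ Γ then 0 else ‖Φ.toFun X.1‖) := fun Γ =>
    Summable.of_nonneg_of_le (fun X => by split_ifs <;> simp) (hle Γ) hΦ
  have e : ∀ a : Fin d → ℕ+,
      (∑ x ∈ box a, Φ.tail (shift (-x) (box a))) / ((box a).card : ℝ) =
      ∑' X : {X : Finset (Site d) // (0 : Site d) ∈ X},
        ‖Φ.toFun X.1‖ * (({x ∈ box a | ¬ X.1 ⊆ shift (-x) (box a)}.card : ℝ) / (box a).card) := by
    intro a
    simp only [tail]
    rw [← Summable.tsum_finsetSum fun x _ => hsum _, ← tsum_div_const]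
    refine tsum_congr fun X => ?_
    rw [Finset.card_filter, Nat.cast_sum, ← mul_div_assoc, Finset.mul_sum]
    congr 1
    refine Finset.sum_congr rfl fun x _ => ?_
    split_ifs <;> simp_all
  simp only [e]
  have h0 : (0 : ℝ) = ∑' X : {X : Finset (Site d) // (0 : Site d) ∈ X}, ‖Φ.toFun X.1‖ * 0 := by simp
  rw [h0]
  refine tendsto_tsum_of_dominated_convergence hΦ (fun X => Tendsto.const_mul _ ?_)
    (Eventually.of_forall fun a X => ?_)
  · have h := tendsto_finsetSum X.1 fun z (_ : z ∈ X.1) => tendsto_box_boundary z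
    rw [Finset.sum_const_zero] at h
    refine squeeze_zero (fun a => div_nonneg (Nat.cast_nonneg _) (Nat.cast_nonneg _)) (fun a => ?_) h
    rw [← Finset.sum_div]
    refine div_le_div_of_nonneg_right ?_ (Nat.cast_nonneg _)
    have hsub : {x ∈ box a | ¬ X.1 ⊆ shift (-x) (box a)} ⊆
        X.1.biUnion fun z => {x ∈ box a | x + z ∉ box a} := by
      intro x hx
      obtain ⟨hx1, hx2⟩ := Finset.mem_filter.1 hx
      obtain ⟨z, hz1, hz2⟩ := Finset.not_subset.1 hx2
      refine Finset.mem_biUnion.2 ⟨z, hz1, Finset.mem_filter.2 ⟨hx1, ?_⟩⟩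
      rwa [mem_shift, sub_neg_eq_add, add_comm] at hz2
    exact_mod_cast (Finset.card_le_card hsub).trans Finset.card_biUnion_le
  · rw [norm_mul, norm_norm]
    refine mul_le_of_le_one_right (norm_nonneg _) ?_
    rw [Real.norm_of_nonneg (div_nonneg (Nat.cast_nonneg _) (Nat.cast_nonneg _))]
    refine div_le_one_of_le₀ ?_ (Nat.cast_nonneg _)
    exact_mod_cast Finset.card_filter_le _ _

variable [NeZero q]

theorem ntr_hamiltonian (Φ : Interaction d q) (Λ : Finset (Site d)) :
    ntr Λ (Φ.hamiltonian Λ) = ∑ X ∈ Λ.powerset, ntr X (Φ.toFun X) := by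
  rw [hamiltonian, map_sum]
  simp only [ntr_embed]
  exact Finset.sum_coe_sort Λ.powerset fun X => ntr X (Φ.toFun X)

theorem uniformState_energy (hs : Summable fun X : {X : Finset (Site d) // (0 : Site d) ∈ X} =>
      ((X.1.card : ℂ)⁻¹) • incl X.1 (Φ.toFun X.1)) :
    (uniformState d q).toFun Φ.energy =
      ∑' X : {X : Finset (Site d) // (0 : Site d) ∈ X}, (X.1.card : ℂ)⁻¹ * ntr X.1 (Φ.toFun X.1) := by
  change traceFunctional d q Φ.energy = _
  rw [energy, (traceFunctional d q).map_tsum hs]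
  refine tsum_congr fun X => ?_
  rw [map_smul, incl_apply, traceFunctional_coe, localTrace_mk, smul_eq_mul]

/-- The mean energy per site in the uniform state converges to the expectation of the specific
energy observable. -/
theorem tendsto_ntr_hamiltonian [NeZero d] (ht : Φ.TranslationInvariant)
    (hΦ : Summable fun X : {X : Finset (Site d) // (0 : Site d) ∈ X} => ‖Φ.toFun X.1‖)
    (hs : Summable fun X : {X : Finset (Site d) // (0 : Site d) ∈ X} =>
      ((X.1.card : ℂ)⁻¹) • incl X.1 (Φ.toFun X.1)) :
    Tendsto (fun a : Fin d → ℕ+ => (ntr (box a) (Φ.hamiltonian (box a))).re / ((box a).card : ℝ))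
      atTop (𝓝 ((uniformState d q).toFun Φ.energy).re) := by
  rw [tendsto_iff_norm_sub_tendsto_zero]
  have hlim := (tendsto_inv_card_box (d := d)).const_mul ‖Φ.toFun ∅‖ |>.add
    (tendsto_average_tail hΦ)
  rw [mul_zero, add_zero] at hlim
  refine squeeze_zero (fun _ => norm_nonneg _) (fun a => ?_) hlim
  have hpos : (0 : ℝ) < (box a).card := by exact_mod_cast card_box_pos a
  set w := (uniformState d q).toFun Φ.energy with hw
  rw [ntr_hamiltonian, sum_powerset_eq_sum_sites (ntr_toFun_shift ht)]
  set e : Site d → ℂ := fun x => ∑ X ∈ (shift (-x) (box a)).powerset with (0 : Site d) ∈ X,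
    (X.card : ℂ)⁻¹ * ntr X (Φ.toFun X) with he
  have hterm : ∀ x, ‖w - e x‖ ≤ Φ.tail (shift (-x) (box a)) := by
    intro x
    rw [hw, uniformState_energy hs]
    refine tsum_sub_sum_le (g := fun X => (X.card : ℂ)⁻¹ * ntr X (Φ.toFun X))
      (b := fun X => ‖Φ.toFun X‖) (fun X => ?_) hΦ _
    rw [norm_mul, norm_inv, Complex.norm_natCast]
    exact (mul_le_of_le_one_left (norm_nonneg _) (Nat.cast_inv_le_one _)).trans (norm_ntr_le _ _)
  -- Each site's share of the energy misses ω(E_Φ) by at most its tail; the empty-set term is an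
  -- additive constant, negligible per site.
  have hmain : ‖(ntr ∅ (Φ.toFun ∅) + ∑ x ∈ box a, e x) - (box a).card * w‖ ≤
      ‖Φ.toFun ∅‖ + ∑ x ∈ box a, Φ.tail (shift (-x) (box a)) := by
    have : (ntr ∅ (Φ.toFun ∅) + ∑ x ∈ box a, e x) - (box a).card * w =
        ntr ∅ (Φ.toFun ∅) - ∑ x ∈ box a, (w - e x) := by
      rw [Finset.sum_sub_distrib, Finset.sum_const, nsmul_eq_mul]; ring
    rw [this]
    refine (norm_sub_le _ _).trans (add_le_add (norm_ntr_le _ _) ?_)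
    exact (norm_sum_le _ _).trans (Finset.sum_le_sum fun x _ => hterm x)
  have hre := (Complex.abs_re_le_norm _).trans hmain
  rw [Complex.sub_re, ← Complex.ofReal_natCast, Complex.re_ofReal_mul] at hre
  have hdiv : ∀ t v B : ℝ, 0 < B → t / B - v = (t - B * v) / B := fun t v B hB => by field_simp
  rw [hdiv _ _ _ hpos, Real.norm_eq_abs, abs_div, abs_of_pos hpos, ← div_eq_mul_inv, ← add_div]
  gcongr

theorem logPartition_le (Φ : Interaction d q) (Λ : Finset (Site d)) {L : Λ → ℝ}
    (hL : ∀ x, ‖Φ.hamiltonian Λ - siteAvg x (Φ.hamiltonian Λ)‖ ≤ L x) :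
    Φ.logPartition Λ ≤ Λ.card * Real.log q - (ntr Λ (Φ.hamiltonian Λ)).re + ∑ x, L x ^ 2 / 2 := by
  have hH := (isSelfAdjoint_hamiltonian Φ Λ).neg
  have h := trace_exp_le_of_norm_sub_siteAvg_le hH (L := L) fun x => by
    rw [map_neg, neg_sub_neg, norm_sub_rev]
    exact hL x
  have hq : (0 : ℝ) < q := Nat.cast_pos.2 (NeZero.pos q)
  have h2 := Real.log_le_log (trace_exp_pos hH) h
  rw [Real.log_mul (pow_pos hq _).ne' (Real.exp_pos _).ne', Real.log_pow, Real.log_exp,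
    Fintype.card_coe, ← ntr_apply, map_neg, Complex.neg_re] at h2
  rw [logPartition]
  linarith

theorem boxPressure_le (ht : Φ.TranslationInvariant)
    (hΦ : Summable fun X : {X : Finset (Site d) // (0 : Site d) ∈ X} => ‖Φ.toFun X.1‖)
    (a : Fin d → ℕ+) :
    Φ.boxPressure a ≤ Real.log q + Φ.lipschitz ^ 2 / 2 -
      (ntr (box a) (Φ.hamiltonian (box a))).re / (box a).card +
      (2 * Φ.lipschitz + 2 * ∑' X : {X : Finset (Site d) // (0 : Site d) ∈ X}, ‖Φ.toFun X.1‖) *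
        ((∑ x ∈ box a, Φ.tail (shift (-x) (box a))) / (box a).card) := by
  set M := ∑' X : {X : Finset (Site d) // (0 : Site d) ∈ X}, ‖Φ.toFun X.1‖ with hM
  have hpos : (0 : ℝ) < (box a).card := by exact_mod_cast card_box_pos a
  have h := Φ.logPartition_le (box a) fun x => norm_hamiltonian_sub_siteAvg_le ht hΦ x
  have hsum : ∑ x : box a, (Φ.lipschitz + 2 * Φ.tail (shift (-x.1) (box a))) ^ 2 / 2 ≤
      (box a).card * (Φ.lipschitz ^ 2 / 2) +
        (2 * Φ.lipschitz + 2 * M) * ∑ x ∈ box a, Φ.tail (shift (-x) (box a)) := by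
    rw [Finset.sum_coe_sort (box a) fun x =>
      (Φ.lipschitz + 2 * Φ.tail (shift (-x) (box a))) ^ 2 / 2, Finset.mul_sum, ← nsmul_eq_mul,
      ← Finset.sum_const, ← Finset.sum_add_distrib]
    refine Finset.sum_le_sum fun x _ => ?_
    have h1 := tail_nonneg Φ (shift (-x) (box a))
    have h2 := tail_le hΦ (shift (-x) (box a))
    -- With tail t ≤ M, (L + 2t)²/2 = L²/2 + 2Lt + 2t² and 2t² ≤ 2Mt, so the error is linear in the
    -- tail and can be averaged.
    nlinarith [mul_le_mul_of_nonneg_left h2 h1]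
  have e : ∀ (l s n c S B : ℝ), 0 < B → (l + s - n / B + c * (S / B)) * B =
      B * l - n + (B * s + c * S) := fun l s n c S B hB => by field_simp; ring
  rw [boxPressure, ← logPartition, div_le_iff₀ hpos, e _ _ _ _ _ _ hpos]
  linarith

theorem le_of_tendsto_boxPressure [NeZero d] (ht : Φ.TranslationInvariant)
    (hΦ : Summable fun X : {X : Finset (Site d) // (0 : Site d) ∈ X} => ‖Φ.toFun X.1‖)
    (hs : Summable fun X : {X : Finset (Site d) // (0 : Site d) ∈ X} =>
      ((X.1.card : ℂ)⁻¹) • incl X.1 (Φ.toFun X.1)) {l : ℝ}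
    (hl : Tendsto Φ.boxPressure atTop (𝓝 l)) :
    l ≤ Real.log q + Φ.lipschitz ^ 2 / 2 - ((uniformState d q).toFun Φ.energy).re := by
  have hrhs := ((tendsto_ntr_hamiltonian ht hΦ hs).const_sub
    (Real.log q + Φ.lipschitz ^ 2 / 2)).add ((tendsto_average_tail hΦ).const_mul (2 * Φ.lipschitz +
      2 * ∑' X : {X : Finset (Site d) // (0 : Site d) ∈ X}, ‖Φ.toFun X.1‖))
  rw [mul_zero, add_zero] at hrhs
  exact le_of_tendsto_of_tendsto' hl hrhs (boxPressure_le ht hΦ)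

end Interaction

end Bound

end QSpin

theorem mainTheorem6 (d q : ℕ) [NeZero d] [NeZero q] (r : ℝ) (hr : 0 < r)
    (Φ : QSpin.Interaction d q) (hΦ : Φ.MemB r) :
    Filter.Tendsto Φ.boxPressure Filter.atTop (nhds Φ.pressure) ∧
      Φ.pressure ≤ Real.log q + Φ.lipschitz ^ 2 / 2
        - ((QSpin.uniformState d q).toFun Φ.energy).re := by
  have ht := hΦ.translationInvariant
  have hn := hΦ.summable_norm hr
  have hlim : Filter.Tendsto Φ.boxPressure Filter.atTop (nhds Φ.pressure) :=
    -- `pressure` is a `limUnder`, so it is the limit once some limit is known to exist.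
    tendsto_nhds_limUnder (QSpin.Interaction.exists_tendsto_boxPressure ht hn)
  refine ⟨hlim, ?_⟩
  exact QSpin.Interaction.le_of_tendsto_boxPressure ht hn (hΦ.summable_energy hr) hlim
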